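/- Let $\alpha>3/2$, $L>0$ and $\lambda\in(0,1)$. For $p\ge 1$ let $\mathcal F(\alpha,L)$ be the set of real symmetric positive semidefinite $p\times p$ matrices $\Sigma=(\sigma_{ij})$ with $\sigma_{ii}=1$ for all $i$ and $\frac1p\sum_{1\le i<j\le p}\sigma_{ij}^2|i-j|^{2\alpha}\le L$, and let $\mathcal G(\alpha,L,\lambda)$ be the set of $\Sigma\in\mathcal F(\alpha,L)$ all of whose eigenvalues are at least $\lambda$. One observes $n$ independent random vectors $X_1,\dots,X_n$ with law $\mathcal N_p(0,\Sigma)$ and tests $H_0:\Sigma^{-1}=I$ against $$H_1(\psi):\ \Sigma\in\mathcal G(\alpha,L,\lambda)\ \text{ with }\ \tfrac1{2p}\|\Sigma^{-1}-I\|_F^2\ge\psi^2,$$ where $\|\cdot\|_F$ is the Frobenius norm and $\psi>0$. A test $\Delta$ is a measurable function of $(X_1,\dots,X_n)$ with values in $[0,1]$; its total error is $$\gamma(\Delta,\psi)=\mathbb E_I(\Delta)+\sup_{\Sigma\in H_1(\psi)}\mathbb E_\Sigma(1-\Delta)$$ (a supremum over the empty set being $0$), and $\gamma(\psi)=\inf_\Delta\gamma(\Delta,\psi)$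 over all tests. Put $$C(\alpha,L)=\frac{2\alpha+1}{(4\alpha+1)^{1+1/(2\alpha)}}\,L^{-1/(2\alpha)},\qquad \widetilde\varphi=\widetilde\varphi_{n,p}=\bigl(n\sqrt p\;C^{1/2}(\alpha,L)\bigr)^{-\frac{2\alpha}{4\alpha+1}}.$$ If $n$ and $p$ tend to infinity in such a way that $n=o(p^{2\alpha})$, then $\widetilde\varphi$ is the asymptotically minimax separation rate for this testing problem, that is, for every $\psi=\psi_{n,p}>0$: 1. if $\psi/\widetilde\varphi\to0$, then $\gamma(\psi)\to1$; 2. if $\psi/\widetilde\varphi\to+\infty$, then there are tests $\Delta^*=\Delta^*_{n,p}$ (which may depend on $\psi_{n,p}$) such that $\gamma(\Delta^*,\psi)\to0$. -/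

import Mathlib

open MeasureTheory ProbabilityTheory Filter Topology Asymptotics
open scoped ENNReal

namespace InverseCovarianceTest

noncomputable section

/-- Joint law of `n` independent centred Gaussian vectors in `ℝ^p` with covariance matrix `S`. -/
def sampleLaw (n p : ℕ) (S : Matrix (Fin p) (Fin p) ℝ) :
    Measure (Fin n → EuclideanSpace ℝ (Fin p)) :=
  Measure.pi fun _ => multivariateGaussian 0 S

/-- A test procedure: a measurable function of the observations with values in `[0, 1]`
(the probability of rejecting the null hypothesis). -/
structure TestProcedure (n p : ℕ) where
  /-- the underlying function of the sample -/
  toFun : (Fin n → EuclideanSpace ℝ (Fin p)) → ℝ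
  measurable_toFun : Measurable toFun
  mem_Icc : ∀ x, toFun x ∈ Set.Icc (0 : ℝ) 1

/-- Type I error: the largest expectation of the test over the null hypothesis `H₀`. -/
def typeIError {n p : ℕ} (Δ : TestProcedure n p) (H₀ : Set (Matrix (Fin p) (Fin p) ℝ)) : ℝ≥0∞ :=
  ⨆ S ∈ H₀, ∫⁻ x, ENNReal.ofReal (Δ.toFun x) ∂(sampleLaw n p S)

/-- Maximal type II error: the supremum of `E_S (1 - Δ)` over the alternative `H₁`. -/
def typeIIError {n p : ℕ} (Δ : TestProcedure n p) (H₁ : Set (Matrix (Fin p) (Fin p) ℝ)) : ℝ≥0∞ :=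
  ⨆ S ∈ H₁, ∫⁻ x, ENNReal.ofReal (1 - Δ.toFun x) ∂(sampleLaw n p S)

/-- Total error of a test. -/
def totalError {n p : ℕ} (Δ : TestProcedure n p) (H₀ H₁ : Set (Matrix (Fin p) (Fin p) ℝ)) :
    ℝ≥0∞ :=
  typeIError Δ H₀ + typeIIError Δ H₁

/-- Minimax total error: the infimum of the total error over all test procedures based on
`n` observations. -/
def minimaxError (n p : ℕ) (H₀ H₁ : Set (Matrix (Fin p) (Fin p) ℝ)) : ℝ≥0∞ :=
  ⨅ Δ : TestProcedure n p, totalError Δ H₀ H₁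

/-- `r` is the asymptotically minimax separation rate, along the sample sizes `n k` and the
dimensions `p k`, for testing `H₀ p` against the alternatives `H₁ p ψ` with separation
radius `ψ`: the hypotheses are indistinguishable when `ψ / r → 0`, and they are consistently
separated by some tests (which may depend on `ψ`) when `ψ / r → ∞`. -/
def IsMinimaxSeparationRate (H₀ : (p : ℕ) → Set (Matrix (Fin p) (Fin p) ℝ))
    (H₁ : (p : ℕ) → ℝ → Set (Matrix (Fin p) (Fin p) ℝ)) (n p : ℕ → ℕ) (r : ℕ → ℝ) : Prop :=
  (∀ ψ : ℕ → ℝ, (∀ k, 0 < ψ k) → Tendsto (fun k => ψ k / r k) atTop (𝓝 0) →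
    Tendsto (fun k => minimaxError (n k) (p k) (H₀ (p k)) (H₁ (p k) (ψ k))) atTop (𝓝 1)) ∧
  (∀ ψ : ℕ → ℝ, (∀ k, 0 < ψ k) → Tendsto (fun k => ψ k / r k) atTop atTop →
    ∃ Δ : (k : ℕ) → TestProcedure (n k) (p k),
      Tendsto (fun k => totalError (Δ k) (H₀ (p k)) (H₁ (p k) (ψ k))) atTop (𝓝 0))

/-- The class `F(α, L)` of `p × p` correlation matrices in an ellipsoid. -/
def classF (α L : ℝ) (p : ℕ) : Set (Matrix (Fin p) (Fin p) ℝ) :=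
  {S | S.PosSemidef ∧ (∀ i, S i i = 1) ∧
    (1 / (p : ℝ)) * ∑ i : Fin p, ∑ j : Fin p,
      (if i < j then S i j ^ 2 * |(i : ℝ) - (j : ℝ)| ^ (2 * α) else 0) ≤ L}

/-- The class `G(α, L, lam)`: matrices of `F(α, L)` all of whose eigenvalues are at least
`lam`. -/
def classG (α L lam : ℝ) (p : ℕ) : Set (Matrix (Fin p) (Fin p) ℝ) :=
  {S | S ∈ classF α L p ∧ ∀ μ ∈ spectrum ℝ S, lam ≤ μ}

/-- The null hypothesis `Σ⁻¹ = I`. -/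
def nullInverse (p : ℕ) : Set (Matrix (Fin p) (Fin p) ℝ) :=
  {S | S.PosSemidef ∧ S⁻¹ = 1}

section Frobenius

attribute [local instance] Matrix.frobeniusNormedAddCommGroup

/-- The alternative: `Σ ∈ G(α, L, lam)` with `(1 / 2p) ‖Σ⁻¹ - I‖²_F ≥ ψ²`. -/
def altInverse (α L lam : ℝ) (p : ℕ) (ψ : ℝ) : Set (Matrix (Fin p) (Fin p) ℝ) :=
  {S | S ∈ classG α L lam p ∧ ψ ^ 2 ≤ (1 / (2 * (p : ℝ))) * ‖S⁻¹ - 1‖ ^ 2}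

end Frobenius

/-- The constant `C(α, L) = (2α + 1) (4α + 1)^{-(1 + 1/(2α))} L^{-1/(2α)}`. -/
def constC (α L : ℝ) : ℝ :=
  (2 * α + 1) / (4 * α + 1) ^ (1 + 1 / (2 * α)) * L ^ (-(1 / (2 * α)))

/-- The rate `(n √p C(α, L)^{1/2})^{-2α/(4α+1)}`. -/
def separationRate (α L : ℝ) (n p : ℕ) : ℝ :=
  ((n : ℝ) * √(p : ℝ) * (constC α L) ^ (1 / 2 : ℝ)) ^ (-(2 * α / (4 * α + 1)))

end

end InverseCovarianceTest

/-! Write `y = (n√p)^{2/(4α+1)}` (`bandwidth`) and `q = ψ y^α`. The rate is a fixed multiple of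
`y^{-α}`, so the constant `C(α, L)` plays no role at the level of rates. What has to be shown is
that the error tends to 1 when `q → 0`, and that some tests have error tending to 0 when `q → ∞`.

Lower bound. Cut the coordinates into `B ≈ p/(2T)` blocks of length `2T`, with `T = ⌈y⌉`; there is
room for them because `n = o(p^{2α})` means `y = o(p)`. In each block take normalised random sign
vectors `u`, `v` on the two halves and let `Q` be the sum of all `uvᵀ + vuᵀ`. Then `Q³ = Q`, so the
eigenvalues of `Q` lie in `{-1, 0, 1}`, and `Σ = 1 + τQ` has an explicit inverse and lies in the
alternative when `τ² = 4Tψ²` (`one_add_smul_signPattern_mem_altInverse`). For two such matrices, the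
likelihood ratios of one observation have mean product `det(1 - τ²QQ')^{-1/2}`. This determinant is
the square of a product over blocks, so the average over the signs factorises. Sub-Gaussian bounds
for the sign sums give `exp(4n²(τ²/T)²B) ≤ exp(32q⁴)` (`sum_sum_det_signPattern_le`), which tends to
1. The second moment method (`one_sub_le_error_of_second_moment`) concludes.

Upper bound. Since `Σ ≥ lam`, a large `‖Σ⁻¹ - 1‖` forces a large `‖Σ - 1‖`
(`frobenius_norm_inv_sub_one_le`), and the ellipsoid condition puts all but `pL T^{-2α}` of the
upper-triangular energy in the band `0 < j - i ≤ T`. Multiplying empirical covariances computed from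
two disjoint half samples estimates the band energy without bias. By Isserlis' formula, the variance
is governed by the operator and Frobenius norms of the covariance of the products `xᵢxⱼ`. The former
is controlled by absolute row sums of `Σ`, which are `O(p^{1/4})`; this is where `α > 3/2` enters
(`sum_abs_row_le`). The latter is controlled by `sum_sum_sq_row_le`. Chebyshev's inequality then
bounds the total error by a multiple of `q^{-2} + q^{-4}`. -/

open scoped NNReal

/-! ### Densities on finite products -/

section PiDensity

variable {ι : Type*} [Fintype ι] {X : ι → Type*} [∀ i, MeasurableSpace (X i)]

theorem lintegral_pi_ofReal_prod (μ : ∀ i, Measure (X i)) [∀ i, SigmaFinite (μ i)]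
    (f : ∀ i, X i → ℝ) (hf0 : ∀ i x, 0 ≤ f i x) (hf : ∀ i, Integrable (f i) (μ i)) :
    ∫⁻ x, ENNReal.ofReal (∏ i, f i (x i)) ∂Measure.pi μ
      = ∏ i, ∫⁻ x, ENNReal.ofReal (f i x) ∂μ i := by
  rw [← ofReal_integral_eq_lintegral_ofReal (Integrable.fintype_prod_dep hf)
    (ae_of_all _ fun x => Finset.prod_nonneg fun i _ => hf0 i _), integral_fintype_prod_eq_prod,
    ENNReal.ofReal_prod_of_nonneg fun i _ => integral_nonneg (hf0 i)]
  exact Finset.prod_congr rfl fun i _ =>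
    ofReal_integral_eq_lintegral_ofReal (hf i) (ae_of_all _ (hf0 i))

theorem pi_withDensity_ofReal (μ : ∀ i, Measure (X i)) [∀ i, SigmaFinite (μ i)]
    (f : ∀ i, X i → ℝ) (hf0 : ∀ i x, 0 ≤ f i x) (hf : ∀ i, Integrable (f i) (μ i)) :
    Measure.pi (fun i => (μ i).withDensity fun x => ENNReal.ofReal (f i x))
      = (Measure.pi μ).withDensity fun x => ENNReal.ofReal (∏ i, f i (x i)) := by
  have (i : ι) : IsFiniteMeasure ((μ i).withDensity fun x => ENNReal.ofReal (f i x)) :=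
    isFiniteMeasure_withDensity_ofReal (hf i).2
  refine Measure.pi_eq fun s hs => ?_
  rw [withDensity_apply _ (MeasurableSet.univ_pi hs), Measure.restrict_pi_pi,
    lintegral_pi_ofReal_prod _ f hf0 fun i => (hf i).restrict]
  exact Finset.prod_congr rfl fun i _ => (withDensity_apply _ (hs i)).symm

end PiDensity

/-! ### Gaussian likelihood ratios and their products -/

section GaussianDensity

open Matrix WithLp

variable {ι : Type*} [Fintype ι]

theorem MeasurableEquiv.map_withDensity {A B : Type*} [MeasurableSpace A] [MeasurableSpace B]
    (e : A ≃ᵐ B) (μ : Measure A) (f : A → ℝ≥0∞) :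
    (μ.withDensity f).map e = (μ.map e).withDensity (f ∘ e.symm) := by
  ext s hs
  rw [Measure.map_apply e.measurable hs, withDensity_apply _ (e.measurable hs),
    withDensity_apply _ hs, e.restrict_map, lintegral_map_equiv]
  simp

theorem stdGaussian_eq_withDensity :
    stdGaussian (EuclideanSpace ℝ ι) = (volume : Measure (EuclideanSpace ℝ ι)).withDensity
      fun x => ENNReal.ofReal ((√(2 * Real.pi))⁻¹ ^ Fintype.card ι * Real.exp (-‖x‖ ^ 2 / 2)) := by
  rw [← map_pi_eq_stdGaussian]
  simp_rw [gaussianReal_of_var_ne_zero 0 (one_ne_zero : (1 : NNReal) ≠ 0)]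
  unfold gaussianPDF
  rw [pi_withDensity_ofReal _ _ (fun _ => gaussianPDFReal_nonneg 0 1)
    (fun _ => integrable_gaussianPDFReal 0 1)]
  rw [← MeasurableEquiv.coe_toLp, MeasurableEquiv.map_withDensity]
  rw [MeasurableEquiv.coe_toLp, ← volume_pi, (PiLp.volume_preserving_toLp ι).map_eq]
  congr 1
  ext x
  simp only [Function.comp, gaussianPDFReal_def, Finset.prod_mul_distrib, ← Real.exp_sum]
  simp [EuclideanSpace.real_norm_sq_eq, Finset.sum_div, neg_div]

variable [DecidableEq ι]

/-- The density of `N(0, S)` with respect to the standard Gaussian measure. -/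
noncomputable def gaussianRatio (S : Matrix ι ι ℝ) (x : EuclideanSpace ℝ ι) : ℝ :=
  (√S.det)⁻¹ * Real.exp ((x ⬝ᵥ x - x ⬝ᵥ S⁻¹ *ᵥ x) / 2)

theorem measurable_gaussianRatio (S : Matrix ι ι ℝ) : Measurable (gaussianRatio S) := by
  apply Continuous.measurable
  unfold gaussianRatio
  simp only [dotProduct, mulVec]
  fun_prop

theorem gaussianRatio_nonneg (S : Matrix ι ι ℝ) (x : EuclideanSpace ℝ ι) :
    0 ≤ gaussianRatio S x := by
  unfold gaussianRatio; positivity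

-- Change of variables: `N(0, S)` is the image of the standard Gaussian under `A = √S`, whose
-- Jacobian is `√(det S)`, and `‖A⁻¹x‖² = xᵀS⁻¹x`.
open scoped MatrixOrder in
theorem multivariateGaussian_eq_withDensity {S : Matrix ι ι ℝ} (hS : S.PosDef) :
    multivariateGaussian 0 S = (stdGaussian (EuclideanSpace ℝ ι)).withDensity
      fun x => ENNReal.ofReal (gaussianRatio S x) := by
  set A := CFC.sqrt S with hA
  have hAA : A * A = S := CFC.sqrt_mul_sqrt_self _ hS.posSemidef.nonneg
  have hdet : A.det * A.det = S.det := by rw [← det_mul, hAA]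
  have hSdet := hS.det_pos
  have hAdet : A.det ≠ 0 := by
    intro h; rw [h] at hdet; simp at hdet; linarith
  have hAt : Aᵀ = A := by
    have := (CFC.sqrt_nonneg S).isSelfAdjoint
    rw [← hA] at this
    simpa [IsSelfAdjoint, star_eq_conjTranspose] using this
  have habs : |A.det| = √S.det := by rw [← hdet, Real.sqrt_mul_self_eq_abs]
  set φ := toEuclideanCLM (𝕜 := ℝ) A with hφ
  have hφdet : LinearMap.det (φ : EuclideanSpace ℝ ι →ₗ[ℝ] EuclideanSpace ℝ ι) = A.det := by
    rw [hφ, coe_toEuclideanCLM_eq_toEuclideanLin]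
    exact LinearMap.det_toLpLin 2 A
  have hunit : IsUnit A.det := isUnit_iff_ne_zero.2 hAdet
  have hinv (M N : Matrix ι ι ℝ) (h : M * N = 1) (x : EuclideanSpace ℝ ι) :
      toEuclideanCLM (𝕜 := ℝ) M (toEuclideanCLM (𝕜 := ℝ) N x) = x := by
    rw [← mul_apply_eq_comp, ← map_mul, h, map_one, one_apply_eq_self]
  let e : EuclideanSpace ℝ ι ≃ᵐ EuclideanSpace ℝ ι :=
    { toFun := φ
      invFun := toEuclideanCLM (𝕜 := ℝ) A⁻¹
      left_inv := hinv _ _ (nonsing_inv_mul _ hunit)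
      right_inv := hinv _ _ (mul_nonsing_inv _ hunit)
      measurable_toFun := φ.continuous.measurable
      measurable_invFun := (toEuclideanCLM (𝕜 := ℝ) A⁻¹).continuous.measurable }
  have hmap : (volume : Measure (EuclideanSpace ℝ ι)).map e
      = ENNReal.ofReal ((√S.det)⁻¹) • volume := by
    have := Measure.map_linearMap_addHaar_eq_smul_addHaar
      (volume : Measure (EuclideanSpace ℝ ι)) (f := φ) (by rwa [hφdet])
    rw [hφdet, abs_inv, habs] at this
    exact this
  have h1 : multivariateGaussian 0 S = (stdGaussian (EuclideanSpace ℝ ι)).map e := by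
    unfold multivariateGaussian
    simp only [zero_add]
    rfl
  have hm1 : Measurable fun x : EuclideanSpace ℝ ι =>
      ENNReal.ofReal ((√(2 * Real.pi))⁻¹ ^ Fintype.card ι * Real.exp (-‖x‖ ^ 2 / 2)) := by
    fun_prop
  rw [h1, stdGaussian_eq_withDensity, MeasurableEquiv.map_withDensity, hmap,
    withDensity_smul_measure, ← withDensity_smul _ (hm1.comp e.symm.measurable),
    ← withDensity_mul _ hm1 (measurable_gaussianRatio S).ennreal_ofReal]
  congr 1
  ext x
  have hquad : ‖e.symm x‖ ^ 2 = x ⬝ᵥ S⁻¹ *ᵥ x := by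
    have : (e.symm x : EuclideanSpace ℝ ι) = toLp 2 (A⁻¹ *ᵥ x.ofLp) := rfl
    rw [this, EuclideanSpace.real_norm_sq_eq, ← hAA, Matrix.mul_inv_rev, ← mulVec_mulVec,
      dotProduct_mulVec, ← mulVec_transpose, transpose_nonsing_inv, hAt]
    simp [dotProduct, sq]
  have hnorm : ‖x‖ ^ 2 = x ⬝ᵥ x := by
    rw [EuclideanSpace.real_norm_sq_eq]; simp [dotProduct, sq]
  simp only [Pi.smul_apply, Function.comp, smul_eq_mul, Pi.mul_apply, gaussianRatio]
  rw [← ENNReal.ofReal_mul (by positivity), ← ENNReal.ofReal_mul (by positivity), hquad, hnorm]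
  congr 1
  rw [show (-(x ⬝ᵥ S⁻¹ *ᵥ x) / 2 : ℝ) = -(x ⬝ᵥ x) / 2 + (x ⬝ᵥ x - x ⬝ᵥ S⁻¹ *ᵥ x) / 2 by ring,
    Real.exp_add]
  ring

theorem lintegral_gaussianRatio {S : Matrix ι ι ℝ} (hS : S.PosDef) :
    ∫⁻ x, ENNReal.ofReal (gaussianRatio S x) ∂stdGaussian (EuclideanSpace ℝ ι) = 1 := by
  rw [← setLIntegral_univ, ← withDensity_apply _ MeasurableSet.univ,
    ← multivariateGaussian_eq_withDensity hS, measure_univ]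

theorem integrable_gaussianRatio {S : Matrix ι ι ℝ} (hS : S.PosDef) :
    Integrable (gaussianRatio S) (stdGaussian (EuclideanSpace ℝ ι)) :=
  ⟨(measurable_gaussianRatio S).aestronglyMeasurable,
    (hasFiniteIntegral_iff_ofReal (ae_of_all _ (gaussianRatio_nonneg S))).2
      (by rw [lintegral_gaussianRatio hS]; exact ENNReal.one_lt_top)⟩

theorem integral_gaussianRatio {S : Matrix ι ι ℝ} (hS : S.PosDef) :
    ∫ x, gaussianRatio S x ∂stdGaussian (EuclideanSpace ℝ ι) = 1 := by
  rw [integral_eq_lintegral_of_nonneg_ae (ae_of_all _ (gaussianRatio_nonneg S))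
    (measurable_gaussianRatio S).aestronglyMeasurable, lintegral_gaussianRatio hS,
    ENNReal.toReal_one]

/-- The exponents add up to the quadratic form of `M = S⁻¹ + S'⁻¹ - 1`, so the product is again a
Gaussian ratio up to a constant, which is read off from `S + S' - SS' = S M S'`. As ratios integrate
to 1, the mixed second moment follows with no further integration. -/
theorem gaussianRatio_mul {S S' : Matrix ι ι ℝ} (hS : S.PosDef) (hS' : S'.PosDef)
    (hM : (S⁻¹ + S'⁻¹ - 1).PosDef) (x : EuclideanSpace ℝ ι) :
    gaussianRatio S x * gaussianRatio S' x
      = (√(S + S' - S * S').det)⁻¹ * gaussianRatio (S⁻¹ + S'⁻¹ - 1)⁻¹ x := by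
  set M := S⁻¹ + S'⁻¹ - 1 with hMdef
  have hMd := hM.det_pos
  have hSd := hS.det_pos
  have hSd' := hS'.det_pos
  have hprod : S + S' - S * S' = S * M * S' := by
    have h1 : S * S⁻¹ = 1 := mul_nonsing_inv _ (isUnit_iff_ne_zero.2 hSd.ne')
    have h2 : S'⁻¹ * S' = 1 := nonsing_inv_mul _ (isUnit_iff_ne_zero.2 hSd'.ne')
    rw [hMdef, mul_sub, mul_add, h1, sub_mul, add_mul, mul_assoc S S'⁻¹ S', h2]
    simp [add_comm]
  unfold gaussianRatio
  rw [hprod, nonsing_inv_nonsing_inv _ (isUnit_iff_ne_zero.2 hMd.ne'), det_nonsing_inv,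
    Ring.inverse_eq_inv', det_mul, det_mul, Real.sqrt_inv, inv_inv, Real.sqrt_mul (by positivity),
    Real.sqrt_mul hSd.le]
  have hexp : Real.exp ((x ⬝ᵥ x - x ⬝ᵥ S⁻¹ *ᵥ x) / 2) * Real.exp ((x ⬝ᵥ x - x ⬝ᵥ S'⁻¹ *ᵥ x) / 2)
      = Real.exp ((x ⬝ᵥ x - x ⬝ᵥ M *ᵥ x) / 2) := by
    rw [← Real.exp_add]
    congr 1
    rw [hMdef, sub_mulVec, add_mulVec, dotProduct_sub, dotProduct_add, one_mulVec]
    ring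
  have := (Real.sqrt_pos.2 hMd).ne'
  calc _ = (√S.det)⁻¹ * (√S'.det)⁻¹ * (Real.exp ((x ⬝ᵥ x - x ⬝ᵥ S⁻¹ *ᵥ x) / 2)
        * Real.exp ((x ⬝ᵥ x - x ⬝ᵥ S'⁻¹ *ᵥ x) / 2)) := by ring
    _ = _ := by rw [hexp]; field_simp

theorem integrable_gaussianRatio_mul {S S' : Matrix ι ι ℝ} (hS : S.PosDef) (hS' : S'.PosDef)
    (hM : (S⁻¹ + S'⁻¹ - 1).PosDef) :
    Integrable (fun x => gaussianRatio S x * gaussianRatio S' x)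
      (stdGaussian (EuclideanSpace ℝ ι)) := by
  simp_rw [gaussianRatio_mul hS hS' hM]
  exact (integrable_gaussianRatio hM.inv).const_mul _

theorem integral_gaussianRatio_mul {S S' : Matrix ι ι ℝ} (hS : S.PosDef) (hS' : S'.PosDef)
    (hM : (S⁻¹ + S'⁻¹ - 1).PosDef) :
    ∫ x, gaussianRatio S x * gaussianRatio S' x ∂stdGaussian (EuclideanSpace ℝ ι)
      = (√(S + S' - S * S').det)⁻¹ := by
  simp_rw [gaussianRatio_mul hS hS' hM]
  rw [integral_const_mul, integral_gaussianRatio hM.inv, mul_one]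

end GaussianDensity

/-- **Second moment method**: a mixture of probability densities whose likelihood ratio has second
moment at most `1 + δ²` cannot be distinguished from the base measure with error below `1 - δ`. -/
theorem one_sub_le_error_of_second_moment {X Ω : Type*} [MeasurableSpace X] (P : Measure X)
    [IsProbabilityMeasure P] [Fintype Ω] [Nonempty Ω] (f : Ω → X → ℝ)
    (hf : ∀ ω, Integrable (f ω) P) (hf1 : ∀ ω, ∫ x, f ω x ∂P = 1)
    (hff : ∀ ω ω', Integrable (fun x => f ω x * f ω' x) P) {δ : ℝ} (hδ : 0 < δ)
    (hs : ∑ ω, ∑ ω', ∫ x, f ω x * f ω' x ∂P ≤ (Fintype.card Ω : ℝ) ^ 2 * (1 + δ ^ 2))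
    (g : X → ℝ) (hgm : Measurable g) (hg : ∀ x, g x ∈ Set.Icc (0 : ℝ) 1) :
    1 - δ ≤ ∫ x, g x ∂P + (∑ ω, ∫ x, (1 - g x) * f ω x ∂P) / Fintype.card Ω := by
  set N := (Fintype.card Ω : ℝ) with hN
  have hN0 : 0 < N := by rw [hN]; exact_mod_cast Fintype.card_pos
  set L : X → ℝ := fun x => (∑ ω, f ω x) / N with hL
  have hgi : Integrable g P := Integrable.of_bound hgm.aestronglyMeasurable 1
    (ae_of_all _ fun x => by rw [Real.norm_eq_abs, abs_of_nonneg (hg x).1]; exact (hg x).2)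
  have hLi : Integrable L P := (integrable_finsetSum _ fun ω _ => hf ω).div_const N
  have hL1 : ∫ x, L x ∂P = 1 := by
    rw [hL, integral_div, integral_finsetSum _ fun ω _ => hf ω]
    simp only [hf1, Finset.sum_const, Finset.card_univ, nsmul_eq_mul, mul_one]
    exact div_self hN0.ne'
  have hLsq : ∀ x, L x ^ 2 = (∑ ω, ∑ ω', f ω x * f ω' x) / N ^ 2 := fun x => by
    rw [hL, div_pow, sq (∑ ω, f ω x), Finset.sum_mul_sum]
  have hL2i : Integrable (fun x => L x ^ 2) P := by
    simp_rw [hLsq]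
    exact (integrable_finsetSum _ fun ω _ => integrable_finsetSum _ fun ω' _ => hff ω ω').div_const _
  have hL2 : ∫ x, L x ^ 2 ∂P ≤ 1 + δ ^ 2 := by
    simp_rw [hLsq]
    rw [integral_div, integral_finsetSum _ fun ω _ => integrable_finsetSum _ fun ω' _ => hff ω ω']
    simp_rw [integral_finsetSum _ fun ω' _ => hff _ ω']
    rw [div_le_iff₀ (by positivity), mul_comm]
    exact hs
  have hbdd : ∀ᵐ x ∂P, ‖1 - g x‖ ≤ 1 := ae_of_all _ fun x => by
    rw [Real.norm_eq_abs, abs_of_nonneg (by linarith [(hg x).2])]; linarith [(hg x).1]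
  have hfg (ω : Ω) : Integrable (fun x => (1 - g x) * f ω x) P :=
    (hf ω).bdd_mul (measurable_const.sub hgm).aestronglyMeasurable hbdd
  have hLg : Integrable (fun x => (1 - g x) * L x) P :=
    hLi.bdd_mul (measurable_const.sub hgm).aestronglyMeasurable hbdd
  have hmix : (∑ ω, ∫ x, (1 - g x) * f ω x ∂P) / N = ∫ x, (1 - g x) * L x ∂P := by
    rw [← integral_finsetSum _ fun ω _ => hfg ω, ← integral_div]
    congr 1
    ext x
    rw [hL, ← Finset.mul_sum, mul_div_assoc]
  rw [hmix, ← integral_add hgi hLg]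
  have i1 : Integrable (fun x => (1 + δ⁻¹) * L x - δ⁻¹ / 2 * L x ^ 2) P :=
    (hLi.const_mul _).sub (hL2i.const_mul _)
  -- The integrand on the left is `L - (δ/2 + (1 - L)²/(2δ))`. A pointwise arithmetic-geometric
  -- bound on `|1 - L|` replaces the Cauchy–Schwarz inequality for the total variation distance.
  have hlow : ∫ x, (((1 + δ⁻¹) * L x - δ⁻¹ / 2 * L x ^ 2) - (δ + δ⁻¹) / 2) ∂P
      ≤ ∫ x, (g x + (1 - g x) * L x) ∂P := by
    refine integral_mono (i1.sub (integrable_const _)) (hgi.add hLg) fun x => ?_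
    have h1 : |1 - L x| ≤ δ / 2 + δ⁻¹ / 2 * (1 - L x) ^ 2 := by
      have h : δ⁻¹ * (δ - |1 - L x|) ^ 2 = δ - 2 * |1 - L x| + δ⁻¹ * (1 - L x) ^ 2 := by
        rw [sub_sq, sq_abs]; field_simp
      have : 0 ≤ δ⁻¹ * (δ - |1 - L x|) ^ 2 := by positivity
      linarith
    have h2 : -|1 - L x| ≤ g x * (1 - L x) := by
      have h3 := abs_mul (g x) (1 - L x)
      have h4 : |g x| * |1 - L x| ≤ 1 * |1 - L x| := by
        gcongr; rw [abs_of_nonneg (hg x).1]; exact (hg x).2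
      linarith [neg_abs_le (g x * (1 - L x))]
    simp only
    linarith
  refine le_trans ?_ hlow
  rw [integral_sub i1 (integrable_const _), integral_sub (hLi.const_mul _) (hL2i.const_mul _),
    integral_const_mul, integral_const_mul, hL1]
  simp only [integral_const, probReal_univ, smul_eq_mul, mul_one, one_mul]
  have : δ⁻¹ / 2 * ∫ x, L x ^ 2 ∂P ≤ δ⁻¹ / 2 * (1 + δ ^ 2) := by gcongr
  have h3 : δ⁻¹ / 2 * (1 + δ ^ 2) = δ⁻¹ / 2 + δ / 2 := by field_simp
  linarith

/-! ### The second moment bound for the minimax error -/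

namespace InverseCovarianceTest

open Matrix

variable {n p : ℕ}

theorem sampleLaw_one : sampleLaw n p 1
    = Measure.pi fun _ : Fin n => stdGaussian (EuclideanSpace ℝ (Fin p)) := by
  simp [sampleLaw]

instance (S : Matrix (Fin p) (Fin p) ℝ) : IsProbabilityMeasure (sampleLaw n p S) := by
  unfold sampleLaw; infer_instance

theorem sampleLaw_eq_withDensity {S : Matrix (Fin p) (Fin p) ℝ} (hS : S.PosDef) :
    sampleLaw n p S = (sampleLaw n p 1).withDensity
      fun x => ENNReal.ofReal (∏ k, gaussianRatio S (x k)) := by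
  rw [sampleLaw_one, sampleLaw, multivariateGaussian_eq_withDensity hS,
    pi_withDensity_ofReal _ _ (fun _ => gaussianRatio_nonneg S)
      fun _ => integrable_gaussianRatio hS]

theorem ofReal_one_sub_le_minimaxError {Ω : Type*} [Fintype Ω] [Nonempty Ω]
    {H₀ H₁ : Set (Matrix (Fin p) (Fin p) ℝ)} (h₀ : 1 ∈ H₀) (S : Ω → Matrix (Fin p) (Fin p) ℝ)
    (h₁ : ∀ ω, S ω ∈ H₁) (hS : ∀ ω, (S ω).PosDef)
    (hM : ∀ ω ω', ((S ω)⁻¹ + (S ω')⁻¹ - 1).PosDef) {δ : ℝ} (hδ : 0 < δ)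
    (hs : ∑ ω, ∑ ω', ((√(S ω + S ω' - S ω * S ω').det)⁻¹) ^ n
      ≤ (Fintype.card Ω : ℝ) ^ 2 * (1 + δ ^ 2)) :
    ENNReal.ofReal (1 - δ) ≤ minimaxError n p H₀ H₁ := by
  refine le_iInf fun Δ => ?_
  have hmeas (ω : Ω) : Measurable fun x : Fin n → EuclideanSpace ℝ (Fin p) =>
      ∏ k, gaussianRatio (S ω) (x k) :=
    Finset.measurable_prod _ fun k _ => (measurable_gaussianRatio _).comp (measurable_pi_apply k)
  have hnn (ω : Ω) (x : Fin n → EuclideanSpace ℝ (Fin p)) :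
      0 ≤ ∏ k, gaussianRatio (S ω) (x k) := Finset.prod_nonneg fun k _ => gaussianRatio_nonneg _ _
  have hkey := one_sub_le_error_of_second_moment (sampleLaw n p 1)
    (fun ω x => ∏ k, gaussianRatio (S ω) (x k))
    (fun ω => by
      rw [sampleLaw_one]
      exact Integrable.fintype_prod_dep fun _ => integrable_gaussianRatio (hS ω))
    (fun ω => by
      rw [sampleLaw_one, integral_fintype_prod_eq_pow, integral_gaussianRatio (hS ω), one_pow])
    (fun ω ω' => by
      simp_rw [← Finset.prod_mul_distrib]
      rw [sampleLaw_one]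
      exact Integrable.fintype_prod_dep
        (f := fun _ x => gaussianRatio (S ω) x * gaussianRatio (S ω') x)
        fun _ => integrable_gaussianRatio_mul (hS ω) (hS ω') (hM ω ω')) hδ
    (by
      simp_rw [← Finset.prod_mul_distrib]
      rw [sampleLaw_one]
      convert hs using 4 with ω _ ω' _
      rw [integral_fintype_prod_eq_pow fun x => gaussianRatio (S ω) x * gaussianRatio (S ω') x,
        integral_gaussianRatio_mul (hS ω) (hS ω') (hM ω ω'), Fintype.card_fin])
    Δ.toFun Δ.measurable_toFun Δ.mem_Icc
  have hI : ENNReal.ofReal (∫ x, Δ.toFun x ∂sampleLaw n p 1) ≤ typeIError Δ H₀ := by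
    rw [ofReal_integral_eq_lintegral_ofReal (Integrable.of_bound
      Δ.measurable_toFun.aestronglyMeasurable 1 (ae_of_all _ fun x => by
        rw [Real.norm_eq_abs, abs_of_nonneg (Δ.mem_Icc x).1]; exact (Δ.mem_Icc x).2))
      (ae_of_all _ fun x => (Δ.mem_Icc x).1)]
    exact le_iSup₂ (f := fun S (_ : S ∈ H₀) =>
      ∫⁻ x, ENNReal.ofReal (Δ.toFun x) ∂(sampleLaw n p S)) 1 h₀
  have hII (ω : Ω) :
      ENNReal.ofReal (∫ x, (1 - Δ.toFun x) * ∏ k, gaussianRatio (S ω) (x k) ∂sampleLaw n p 1)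
        ≤ typeIIError Δ H₁ := by
    have h01 x : 0 ≤ 1 - Δ.toFun x := by linarith [(Δ.mem_Icc x).2]
    have hm : Measurable fun x => 1 - Δ.toFun x := measurable_const.sub Δ.measurable_toFun
    refine le_trans (le_of_eq ?_) (le_iSup₂ (f := fun S (_ : S ∈ H₁) =>
      ∫⁻ x, ENNReal.ofReal (1 - Δ.toFun x) ∂(sampleLaw n p S)) (S ω) (h₁ ω))
    rw [ofReal_integral_eq_lintegral_ofReal _ (ae_of_all _ fun x => mul_nonneg (h01 x) (hnn ω x)),
      sampleLaw_eq_withDensity (hS ω),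
      lintegral_withDensity_eq_lintegral_mul _ (hmeas ω).ennreal_ofReal hm.ennreal_ofReal]
    · refine lintegral_congr fun x => ?_
      rw [ENNReal.ofReal_mul (h01 x), Pi.mul_apply, mul_comm]
    · refine Integrable.bdd_mul (c := 1) ?_ hm.aestronglyMeasurable (ae_of_all _ fun x => ?_)
      · rw [sampleLaw_one]
        exact Integrable.fintype_prod_dep fun _ => integrable_gaussianRatio (hS ω)
      · rw [Real.norm_eq_abs, abs_of_nonneg (h01 x)]; linarith [(Δ.mem_Icc x).1]
  have hN : 0 < (Fintype.card Ω : ℝ) := by exact_mod_cast Fintype.card_pos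
  -- The worst type II error dominates the average one, so the bound for the uniform mixture
  -- transfers to a single matrix of the family.
  obtain ⟨ω₀, -, hω₀⟩ := Finset.exists_max_image Finset.univ
    (fun ω => ∫ x, (1 - Δ.toFun x) * ∏ k, gaussianRatio (S ω) (x k) ∂sampleLaw n p 1)
    Finset.univ_nonempty
  have havg : (∑ ω, ∫ x, (1 - Δ.toFun x) * ∏ k, gaussianRatio (S ω) (x k) ∂sampleLaw n p 1)
      / Fintype.card Ω
      ≤ ∫ x, (1 - Δ.toFun x) * ∏ k, gaussianRatio (S ω₀) (x k) ∂sampleLaw n p 1 := by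
    rw [div_le_iff₀ hN]
    refine (Finset.sum_le_card_nsmul _ _ _ hω₀).trans (le_of_eq ?_)
    rw [nsmul_eq_mul, Finset.card_univ, mul_comm]
  calc ENNReal.ofReal (1 - δ) ≤ ENNReal.ofReal (∫ x, Δ.toFun x ∂sampleLaw n p 1
        + ∫ x, (1 - Δ.toFun x) * ∏ k, gaussianRatio (S ω₀) (x k) ∂sampleLaw n p 1) :=
        ENNReal.ofReal_le_ofReal (hkey.trans (add_le_add le_rfl havg))
    _ ≤ _ := ENNReal.ofReal_add_le.trans (add_le_add hI (hII ω₀))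

theorem minimaxError_le_one (H₀ H₁ : Set (Matrix (Fin p) (Fin p) ℝ)) :
    minimaxError n p H₀ H₁ ≤ 1 := by
  refine (iInf_le _ ⟨fun _ => 0, measurable_const, fun _ => by simp⟩).trans ?_
  simp [totalError, typeIError, typeIIError]

end InverseCovarianceTest

/-! ### Spectral lower bounds and the Frobenius norm -/

section SpectralBound

open Matrix
open scoped Pointwise

variable {ι : Type*} [Fintype ι]

theorem Matrix.forall_spectrum_le_iff_posSemidef_sub [DecidableEq ι] {S : Matrix ι ι ℝ} (hS : S.PosSemidef)
    (l : ℝ) : (∀ μ ∈ spectrum ℝ S, l ≤ μ) ↔ (S - l • (1 : Matrix ι ι ℝ)).PosSemidef := by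
  have hH : (S - l • (1 : Matrix ι ι ℝ)).IsHermitian := by
    refine hS.isHermitian.sub ?_
    simp [IsHermitian]
  have hspec : spectrum ℝ (S - l • (1 : Matrix ι ι ℝ)) = spectrum ℝ S - ({l} : Set ℝ) := by
    rw [spectrum.sub_singleton_eq, Algebra.algebraMap_eq_smul_one]
  rw [posSemidef_iff_isHermitian_and_spectrum_nonneg, hspec]
  simp only [hH, true_and, Set.sub_singleton, Set.image_subset_iff]
  exact forall₂_congr fun μ _ => by simp

section Frobenius

attribute [local instance] Matrix.frobeniusNormedAddCommGroup

theorem Matrix.frobenius_norm_sq (A : Matrix ι ι ℝ) : ‖A‖ ^ 2 = ∑ i, ∑ j, A i j ^ 2 := by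
  rw [frobenius_norm_def, ← Real.rpow_natCast, ← Real.rpow_mul (by positivity)]
  norm_num

theorem Matrix.frobenius_norm_sq_eq_trace (A : Matrix ι ι ℝ) : ‖A‖ ^ 2 = (Aᵀ * A).trace := by
  rw [frobenius_norm_sq, Finset.sum_comm]
  simp [trace, mul_apply, sq]

end Frobenius

end SpectralBound

/-! ### Perturbations `1 + τQ` with `Q` symmetric and `Q³ = Q` -/

section TripotentPerturbation

open Matrix

variable {ι : Type*} [Fintype ι] {Q : Matrix ι ι ℝ}

theorem posSemidef_sq_of_transpose_eq (hQt : Qᵀ = Q) : (Q * Q).PosSemidef := by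
  have := posSemidef_conjTranspose_mul_self Q
  rwa [conjTranspose_eq_transpose_of_trivial, hQt] at this

variable [DecidableEq ι]

/-- On the eigenvalues 0, 1, -1 of `Q` the sum takes the values 1, 2, 0. Here `1 - Q²` and `(Q +
Q²)/2` are the spectral projections for 0 and 1, which exhibits `1 + Q` as a positive combination of
squares. -/
theorem posSemidef_one_add_of_tripotent (hQt : Qᵀ = Q) (hQ : Q * Q * Q = Q) :
    (1 + Q).PosSemidef := by
  have h1 : (1 + Q) = (1 - Q * Q) * (1 - Q * Q) + (1 / 2 : ℝ) • ((Q + Q * Q) * (Q + Q * Q)) := by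
    have h4 : Q * Q * (Q * Q) = Q * Q := by rw [← mul_assoc, hQ]
    have h3 : Q * (Q * Q) = Q := by rw [← mul_assoc, hQ]
    simp only [mul_sub, sub_mul, mul_add, add_mul, one_mul, mul_one, h4, h3, hQ]
    module
  rw [h1]
  refine (posSemidef_sq_of_transpose_eq (by simp [hQt])).add
    ((posSemidef_sq_of_transpose_eq (by simp [hQt])).smul (by norm_num))

theorem posSemidef_one_sub_of_tripotent (hQt : Qᵀ = Q) (hQ : Q * Q * Q = Q) :
    (1 - Q).PosSemidef := by
  rw [sub_eq_add_neg]
  exact posSemidef_one_add_of_tripotent (by simp [hQt]) (by simp [hQ])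

theorem posSemidef_one_add_smul_sub (hQt : Qᵀ = Q) (hQ : Q * Q * Q = Q) {τ l : ℝ} (hτ : 0 ≤ τ)
    (hl : l ≤ 1 - τ) : (1 + τ • Q - l • (1 : Matrix ι ι ℝ)).PosSemidef := by
  have : 1 + τ • Q - l • (1 : Matrix ι ι ℝ) = (1 - τ - l) • (1 : Matrix ι ι ℝ) + τ • (1 + Q) := by
    module
  rw [this]
  exact (PosSemidef.one.smul (by linarith)).add ((posSemidef_one_add_of_tripotent hQt hQ).smul hτ)

theorem posDef_one_add_smul (hQt : Qᵀ = Q) (hQ : Q * Q * Q = Q) {τ : ℝ} (hτ : 0 ≤ τ)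
    (hτ1 : τ < 1) : (1 + τ • Q).PosDef := by
  have : 1 + τ • Q = (1 - τ) • (1 : Matrix ι ι ℝ) + τ • (1 + Q) := by module
  rw [this]
  exact (PosDef.one.smul (by linarith)).add_posSemidef
    ((posSemidef_one_add_of_tripotent hQt hQ).smul hτ)

/-- The Neumann series collapses: odd powers of `Q` equal `Q`, positive even powers equal `Q²`, and
two geometric series in `τ²` remain. -/
theorem inv_one_add_smul (hQ : Q * Q * Q = Q) {τ : ℝ} (hτ : 0 ≤ τ) (hτ1 : τ < 1) :
    (1 + τ • Q)⁻¹ = 1 + (1 - τ ^ 2)⁻¹ • (τ ^ 2 • (Q * Q) - τ • Q) := by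
  have h0 : 1 - τ ^ 2 ≠ 0 := by nlinarith
  apply inv_eq_right_inv
  have h3 : Q * (Q * Q) = Q := by rw [← mul_assoc, hQ]
  have h5 : (1 + τ • Q) * (τ ^ 2 • (Q * Q) - τ • Q) = (1 - τ ^ 2) • (-(τ • Q)) := by
    simp only [add_mul, mul_sub, one_mul, smul_mul_assoc, mul_smul_comm, h3]
    module
  rw [mul_add, mul_one, mul_smul_comm, h5, smul_smul, inv_mul_cancel₀ h0, one_smul]
  abel

/-- The eigenvalues of the inverse are at least `1/(1 + τ) > 1/2`. Two such bounds add up to the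
positivity that makes the mixed second moment of likelihood ratios finite. -/
theorem posDef_inv_one_add_smul_sub_half (hQt : Qᵀ = Q) (hQ : Q * Q * Q = Q) {τ : ℝ} (hτ : 0 ≤ τ)
    (hτ1 : τ ≤ 1 / 3) : ((1 + τ • Q)⁻¹ - (1 / 2 : ℝ) • (1 : Matrix ι ι ℝ)).PosDef := by
  have h0 : 0 < 1 - τ ^ 2 := by nlinarith
  rw [inv_one_add_smul hQ hτ (by linarith)]
  have hc : (1 - τ ^ 2)⁻¹ * τ < 1 / 2 := by
    rw [inv_mul_lt_iff₀ h0]; nlinarith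
  have : 1 + (1 - τ ^ 2)⁻¹ • (τ ^ 2 • (Q * Q) - τ • Q) - (1 / 2 : ℝ) • (1 : Matrix ι ι ℝ)
      = (1 / 2 - (1 - τ ^ 2)⁻¹ * τ) • (1 : Matrix ι ι ℝ) + (((1 - τ ^ 2)⁻¹ * τ) • (1 - Q)
        + ((1 - τ ^ 2)⁻¹ * τ ^ 2) • (Q * Q)) := by module
  rw [this]
  exact (PosDef.one.smul (by linarith)).add_posSemidef
    (((posSemidef_one_sub_of_tripotent hQt hQ).smul (by positivity)).add
      ((posSemidef_sq_of_transpose_eq hQt).smul (by positivity)))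

theorem posDef_inv_add_inv_sub_one {Q' : Matrix ι ι ℝ} (hQt : Qᵀ = Q) (hQ : Q * Q * Q = Q)
    (hQt' : Q'ᵀ = Q') (hQ' : Q' * Q' * Q' = Q') {τ : ℝ} (hτ : 0 ≤ τ) (hτ1 : τ ≤ 1 / 3) :
    ((1 + τ • Q)⁻¹ + (1 + τ • Q')⁻¹ - 1).PosDef := by
  have := (posDef_inv_one_add_smul_sub_half hQt hQ hτ hτ1).add
    (posDef_inv_one_add_smul_sub_half hQt' hQ' hτ hτ1)
  convert this using 1
  module

section Frobenius

attribute [local instance] Matrix.frobeniusNormedAddCommGroup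

/-- The square of `(1 + τQ)⁻¹ - 1` is a combination of `Q²` and `Q`; the `Q` part, which has
negative sign, is traceless, and the coefficient of `Q²` is at least `τ²`. -/
theorem le_frobenius_norm_sq_inv_one_add_smul_sub_one (hQt : Qᵀ = Q) (hQ : Q * Q * Q = Q)
    (htr : Q.trace = 0) {τ : ℝ} (hτ : 0 ≤ τ) (hτ1 : τ < 1) :
    τ ^ 2 * (Q * Q).trace ≤ ‖(1 + τ • Q)⁻¹ - 1‖ ^ 2 := by
  have h0 : 0 < 1 - τ ^ 2 := by nlinarith
  have h4 : Q * Q * (Q * Q) = Q * Q := by rw [← mul_assoc, hQ]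
  have h3 : Q * (Q * Q) = Q := by rw [← mul_assoc, hQ]
  rw [inv_one_add_smul hQ hτ hτ1, add_sub_cancel_left, Matrix.frobenius_norm_sq_eq_trace]
  have hmul : ((1 - τ ^ 2)⁻¹ • (τ ^ 2 • (Q * Q) - τ • Q))ᵀ
      * ((1 - τ ^ 2)⁻¹ • (τ ^ 2 • (Q * Q) - τ • Q))
      = ((1 - τ ^ 2)⁻¹ ^ 2 * (τ ^ 4 + τ ^ 2)) • (Q * Q)
        - ((1 - τ ^ 2)⁻¹ ^ 2 * (2 * τ ^ 3)) • Q := by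
    simp only [transpose_smul, transpose_sub, transpose_mul, hQt, smul_mul_assoc, mul_smul_comm,
      sub_mul, mul_sub, h4, h3, hQ]
    module
  rw [hmul, trace_sub, trace_smul, trace_smul, htr, smul_zero, sub_zero, smul_eq_mul]
  have htr2 : 0 ≤ (Q * Q).trace := (posSemidef_sq_of_transpose_eq hQt).trace_nonneg
  have h1 : 1 ≤ (1 - τ ^ 2)⁻¹ := (one_le_inv₀ h0).2 (by nlinarith)
  gcongr
  calc τ ^ 2 ≤ 1 * (τ ^ 4 + τ ^ 2) := by nlinarith [pow_nonneg hτ 4]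
    _ ≤ _ := by gcongr; exact one_le_pow₀ h1

end Frobenius

end TripotentPerturbation

/-! ### Tripotent matrices `W K Wᵀ` from an involution `K` -/

section SwapMatrix

open Matrix

variable {ι κ : Type*} [Fintype κ]

/-- `W K Wᵀ`, where `K` is the permutation matrix of `σ`. -/
def swapGram (σ : κ ≃ κ) (W : Matrix ι κ ℝ) : Matrix ι ι ℝ := W.submatrix id σ * Wᵀ

variable {σ : κ ≃ κ} {W W' : Matrix ι κ ℝ}

theorem submatrix_mul_transpose_of_involutive (hσ : ∀ c, σ (σ c) = c) (W : Matrix ι κ ℝ) :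
    W * (W.submatrix id σ)ᵀ = W.submatrix id σ * Wᵀ := by
  ext i j
  simp only [mul_apply, submatrix_apply, transpose_apply, id]
  exact Fintype.sum_equiv σ _ _ fun c => by rw [hσ]

theorem swapGram_transpose (hσ : ∀ c, σ (σ c) = c) (W : Matrix ι κ ℝ) :
    (swapGram σ W)ᵀ = swapGram σ W := by
  rw [swapGram, transpose_mul, transpose_transpose, submatrix_mul_transpose_of_involutive hσ]

variable [Fintype ι] [DecidableEq κ]

theorem submatrix_transpose_mul_submatrix {κ : Type*} [DecidableEq κ] {σ : κ ≃ κ} {W W' : Matrix ι κ ℝ}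
    {d : κ → ℝ} (h : Wᵀ * W' = diagonal d) :
    (W.submatrix id σ)ᵀ * W'.submatrix id σ = diagonal (d ∘ σ) := by
  rw [transpose_submatrix, ← submatrix_mul _ _ σ id σ Function.bijective_id, h,
    submatrix_diagonal_equiv]

theorem swapGram_mul_self (hσ : ∀ c, σ (σ c) = c) (hW : Wᵀ * W = 1) :
    swapGram σ W * swapGram σ W = W.submatrix id σ * (W.submatrix id σ)ᵀ := by
  nth_rewrite 2 [swapGram]
  rw [← submatrix_mul_transpose_of_involutive hσ, swapGram, Matrix.mul_assoc, ← Matrix.mul_assoc Wᵀ, hW, Matrix.one_mul]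

theorem swapGram_tripotent (hσ : ∀ c, σ (σ c) = c) (hW : Wᵀ * W = 1) :
    swapGram σ W * swapGram σ W * swapGram σ W = swapGram σ W := by
  have h : (W.submatrix id σ)ᵀ * W.submatrix id σ = 1 := by
    rw [submatrix_transpose_mul_submatrix (d := 1) (by simpa using hW)]; simp
  rw [swapGram_mul_self hσ hW, swapGram, Matrix.mul_assoc, ← Matrix.mul_assoc _ _ Wᵀ, h, Matrix.one_mul]

theorem trace_swapGram_mul_self (hσ : ∀ c, σ (σ c) = c) (hW : Wᵀ * W = 1) :
    (swapGram σ W * swapGram σ W).trace = Fintype.card κ := by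
  rw [swapGram_mul_self hσ hW, trace_mul_comm,
    submatrix_transpose_mul_submatrix (d := 1) (by simpa using hW)]
  simp

variable [DecidableEq ι]

/-- Sylvester's identity `det(1 - XY) = det(1 - YX)` moves the determinant to the small index set
`κ`, where everything is diagonal because `WᵀW'` is. -/
theorem det_one_sub_swapGram_mul (hσ : ∀ c, σ (σ c) = c) {d : κ → ℝ}
    (h : Wᵀ * W' = diagonal d) (τ : ℝ) :
    (1 - (τ • swapGram σ W) * (τ • swapGram σ W')).det = ∏ c, (1 - τ ^ 2 * (d (σ c) * d c)) := by
  have h' : W'ᵀ * W = diagonal d := by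
    rw [← transpose_transpose W, ← transpose_mul, h, diagonal_transpose]
  have hmul : (τ • swapGram σ W) * (τ • swapGram σ W')
      = W.submatrix id σ * (τ ^ 2 • (diagonal d * (W'.submatrix id σ)ᵀ)) := by
    nth_rewrite 2 [swapGram]
    rw [← submatrix_mul_transpose_of_involutive hσ, swapGram, smul_mul_smul_comm, Matrix.mul_assoc,
      ← Matrix.mul_assoc Wᵀ, h, Matrix.mul_smul, sq]
  rw [hmul, det_one_sub_mul_comm, Matrix.smul_mul, Matrix.mul_assoc,
    submatrix_transpose_mul_submatrix h', diagonal_mul_diagonal, ← diagonal_one, ← diagonal_smul,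
    diagonal_sub, det_diagonal]
  refine Finset.prod_congr rfl fun c _ => ?_
  simp [mul_comm]

end SwapMatrix

/-! ### Normalised sign vectors with disjoint supports -/

section SignMatrix

open Matrix

variable {ι κ : Type*} [DecidableEq ι] {T : ℕ}

/-- The matrix whose column `c` is the normalised sign vector `s c`, placed by `e`. -/
noncomputable def signMatrix (e : κ × Fin T → ι) (s : κ → Fin T → ℤˣ) : Matrix ι κ ℝ :=
  Matrix.of fun i c => ∑ r, if e (c, r) = i then ((s c r : ℤ) : ℝ) / √T else 0

variable {e : κ × Fin T → ι}

theorem signMatrix_ne_zero {s : κ → Fin T → ℤˣ} {i : ι} {c : κ} (h : signMatrix e s i c ≠ 0) :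
    ∃ r, e (c, r) = i := by
  simp only [signMatrix, of_apply] at h
  obtain ⟨r, -, hr⟩ := Finset.exists_ne_zero_of_sum_ne_zero h
  exact ⟨r, by by_contra h; simp [h] at hr⟩

variable [Fintype ι] [DecidableEq κ]

/-- Injectivity of `e` makes the supports of distinct columns disjoint, even between two different
sign choices. -/
theorem signMatrix_transpose_mul (he : Function.Injective e) (s s' : κ → Fin T → ℤˣ) :
    (signMatrix e s)ᵀ * signMatrix e s'
      = diagonal fun c => (∑ r, (((s * s') c r : ℤˣ) : ℤ) : ℝ) / T := by
  ext c c'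
  simp only [mul_apply, transpose_apply, signMatrix, of_apply, Finset.sum_mul, diagonal_apply]
  rw [Finset.sum_comm]
  simp only [ite_mul, zero_mul, Finset.sum_ite_eq, Finset.mem_univ, if_true, he.eq_iff,
    Prod.mk.injEq]
  split_ifs with h
  · subst h
    simp only [true_and, Finset.sum_ite_eq', Finset.mem_univ, if_true, Finset.sum_div]
    refine Finset.sum_congr rfl fun r _ => ?_
    rw [div_mul_div_comm, Real.mul_self_sqrt (Nat.cast_nonneg T)]
    simp
  · simp [Ne.symm h]

theorem signMatrix_transpose_mul_self (hT : T ≠ 0) (he : Function.Injective e)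
    (s : κ → Fin T → ℤˣ) : (signMatrix e s)ᵀ * signMatrix e s = 1 := by
  rw [signMatrix_transpose_mul he, ← diagonal_one]
  congr 1
  ext c
  have : s * s = 1 := by ext c r; simp
  rw [this]
  simp [hT]

end SignMatrix

/-! ### The least favourable covariance matrices -/

namespace InverseCovarianceTest

open Matrix

/-- Swapping the two halves of every block. -/
def swapHalves (B : ℕ) : Fin B × Bool ≃ Fin B × Bool := (Equiv.refl _).prodCongr Equiv.boolNot

theorem swapHalves_involutive (B : ℕ) (c : Fin B × Bool) : swapHalves B (swapHalves B c) = c := by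
  simp [swapHalves, Prod.map]

/-- The position in `Fin p` of the `r`-th element of a half block. -/
def blockPos {B T p : ℕ} (h : 2 * T * B ≤ p) (x : (Fin B × Bool) × Fin T) : Fin p :=
  ⟨2 * T * x.1.1 + (if x.1.2 then T else 0) + x.2, by
    have h1 := x.1.1.2
    have h2 := x.2.2
    have h3 : 2 * T * (x.1.1 + 1) ≤ 2 * T * B := Nat.mul_le_mul_left _ h1
    rw [mul_add] at h3
    split_ifs <;> omega⟩

variable {B T p : ℕ}

theorem blockPos_injective (h : 2 * T * B ≤ p) : Function.Injective (blockPos h) := by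
  rintro ⟨⟨b, c⟩, r⟩ ⟨⟨b', c'⟩, r'⟩ heq
  have h1 : 2 * T * (b : ℕ) + ((if c then T else 0) + r)
      = 2 * T * (b' : ℕ) + ((if c' then T else 0) + r') := by
    have := congrArg Fin.val heq
    simpa [blockPos, add_assoc] using this
  have hr := r.2
  have hr' := r'.2
  have l1 : (if c then T else 0) + (r : ℕ) < 2 * T := by split_ifs <;> omega
  have l2 : (if c' then T else 0) + (r' : ℕ) < 2 * T := by split_ifs <;> omega
  have hb : (b : ℕ) = b' := by
    have hpos : 0 < 2 * T := by omega
    have := congrArg (· / (2 * T)) h1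
    simpa [Nat.mul_add_div hpos, Nat.div_eq_of_lt l1, Nat.div_eq_of_lt l2] using this
  rw [hb] at h1
  have h2 := Nat.add_left_cancel h1
  have hbb : b = b' := Fin.ext hb
  subst hbb
  cases c <;> cases c' <;> simp at h2 ⊢
  · exact Fin.ext h2
  · omega
  · omega
  · exact Fin.ext h2

/-- The tripotent sign pattern of the least favourable covariance matrices. -/
noncomputable def signPattern (h : 2 * T * B ≤ p) (s : Fin B → Bool → Fin T → ℤˣ) :
    Matrix (Fin p) (Fin p) ℝ :=
  swapGram (swapHalves B) (signMatrix (blockPos h) fun c => s c.1 c.2)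

variable {h : 2 * T * B ≤ p} {s : Fin B → Bool → Fin T → ℤˣ}

/-- A nonzero entry couples the two different halves of one block, and a block has length `2T`. -/
theorem signPattern_ne_zero {i j : Fin p} (hij : signPattern h s i j ≠ 0) :
    i ≠ j ∧ |(i : ℝ) - (j : ℝ)| ≤ 2 * T := by
  obtain ⟨⟨b, c⟩, -, hc⟩ := Finset.exists_ne_zero_of_sum_ne_zero hij
  simp only [submatrix_apply, transpose_apply, id] at hc
  obtain ⟨r, rfl⟩ := signMatrix_ne_zero (left_ne_zero_of_mul hc)
  obtain ⟨r', rfl⟩ := signMatrix_ne_zero (right_ne_zero_of_mul hc)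
  refine ⟨fun heq => ?_, ?_⟩
  · have := blockPos_injective h heq
    simp [swapHalves] at this
  · have hr : ((r : ℕ) : ℝ) ≤ T := by exact_mod_cast r.2.le
    have hr' : ((r' : ℕ) : ℝ) ≤ T := by exact_mod_cast r'.2.le
    have h0 : (0 : ℝ) ≤ (r : ℕ) := Nat.cast_nonneg _
    have h0' : (0 : ℝ) ≤ (r' : ℕ) := Nat.cast_nonneg _
    rw [abs_le]
    cases c <;> simp [swapHalves, blockPos] <;> constructor <;> linarith

theorem signPattern_transpose : (signPattern h s)ᵀ = signPattern h s :=
  swapGram_transpose (swapHalves_involutive B) _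

theorem signPattern_tripotent (hT : T ≠ 0) :
    signPattern h s * signPattern h s * signPattern h s = signPattern h s :=
  swapGram_tripotent (swapHalves_involutive B)
    (signMatrix_transpose_mul_self hT (blockPos_injective h) _)

theorem trace_signPattern_mul_self (hT : T ≠ 0) :
    (signPattern h s * signPattern h s).trace = 2 * B := by
  rw [signPattern, trace_swapGram_mul_self (swapHalves_involutive B)
    (signMatrix_transpose_mul_self hT (blockPos_injective h) _)]
  simp [mul_comm]

theorem signPattern_diag (i : Fin p) : signPattern h s i i = 0 := by
  by_contra hne
  exact (signPattern_ne_zero hne).1 rfl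

/-- The outer square appears because the two halves of a block contribute the same factor. It
cancels the square root in the Gaussian second moment. -/
theorem det_signPattern (s s' : Fin B → Bool → Fin T → ℤˣ) (τ : ℝ) :
    ((1 + τ • signPattern h s) + (1 + τ • signPattern h s')
      - (1 + τ • signPattern h s) * (1 + τ • signPattern h s')).det
      = (∏ b, (1 - τ ^ 2 * ∏ c, ((∑ r, (((s * s') b c r : ℤˣ) : ℤ) : ℝ) / T))) ^ 2 := by
  have : (1 + τ • signPattern h s) + (1 + τ • signPattern h s')
      - (1 + τ • signPattern h s) * (1 + τ • signPattern h s')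
      = 1 - (τ • signPattern h s) * (τ • signPattern h s') := by
    simp only [mul_add, add_mul, mul_one, one_mul]; abel
  rw [this, signPattern, signPattern, det_one_sub_swapGram_mul (swapHalves_involutive B)
    (signMatrix_transpose_mul (blockPos_injective h) _ _), Fintype.prod_prod_type,
    ← Finset.prod_pow]
  refine Finset.prod_congr rfl fun b _ => ?_
  simp only [Fintype.prod_bool, swapHalves, Pi.mul_apply]
  simp
  ring

theorem sum_sq_signPattern (hT : T ≠ 0) :
    ∑ i, ∑ j, signPattern h s i j ^ 2 = 2 * B := by
  rw [← trace_signPattern_mul_self (h := h) (s := s) hT]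
  simp only [trace, diag_apply, mul_apply]
  refine Finset.sum_congr rfl fun i _ => Finset.sum_congr rfl fun j _ => ?_
  rw [sq]
  congr 1
  exact congrFun (congrFun signPattern_transpose.symm i) j

/-- The pattern has total square `2B`. Hypothesis `hL` is the ellipsoid bound with every distance
replaced by `2T` and both triangles counted; `hψ` is the separation obtained from `tr Q² = 2B`. -/
theorem one_add_smul_signPattern_mem_altInverse {α L lam ψ τ : ℝ} (hT : T ≠ 0) (hα : 0 ≤ α)
    (hτ : 0 ≤ τ) (hτ1 : τ < 1) (hlam : lam ≤ 1 - τ)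
    (hL : 2 * B * τ ^ 2 * (2 * T : ℝ) ^ (2 * α) ≤ p * L)
    (hψ : p * ψ ^ 2 ≤ B * τ ^ 2) (hp : 0 < p) :
    1 + τ • signPattern h s ∈ altInverse α L lam p ψ := by
  have hp' : (0 : ℝ) < p := by exact_mod_cast hp
  have hpd := posDef_one_add_smul (signPattern_transpose (h := h) (s := s))
    (signPattern_tripotent hT) hτ hτ1
  refine ⟨⟨⟨hpd.posSemidef, fun i => by simp [signPattern_diag], ?_⟩, ?_⟩, ?_⟩
  · rw [one_div, inv_mul_le_iff₀ hp']
    refine le_trans ?_ hL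
    calc _ ≤ ∑ i : Fin p, ∑ j : Fin p, signPattern h s i j ^ 2 * (τ ^ 2 * (2 * T : ℝ) ^ (2 * α)) := by
          refine Finset.sum_le_sum fun i _ => Finset.sum_le_sum fun j _ => ?_
          split_ifs with hij
          · by_cases h0 : signPattern h s i j = 0
            · simp [h0, hij.ne]
            · have := (signPattern_ne_zero h0).2
              rw [Matrix.add_apply, one_apply_ne hij.ne, zero_add, Matrix.smul_apply, smul_eq_mul, mul_pow,
                mul_comm (τ ^ 2), mul_assoc]
              gcongr
          · positivity
      _ = _ := by
          simp_rw [← Finset.sum_mul]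
          rw [sum_sq_signPattern hT]
          ring
  · rw [Matrix.forall_spectrum_le_iff_posSemidef_sub hpd.posSemidef]
    exact posSemidef_one_add_smul_sub signPattern_transpose (signPattern_tripotent hT) hτ hlam
  · have := le_frobenius_norm_sq_inv_one_add_smul_sub_one (signPattern_transpose (h := h) (s := s))
      (signPattern_tripotent hT) (by simp [trace, signPattern_diag]) hτ hτ1
    rw [trace_signPattern_mul_self hT] at this
    rw [one_div, le_inv_mul_iff₀ (by positivity)]
    refine le_trans ?_ this
    linarith

end InverseCovarianceTest

/-! ### Exponential moments of sums of random signs -/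

section SignSums

/-- The sum of a vector of signs. -/
def signSum {T : ℕ} (w : Fin T → ℤˣ) : ℝ := ∑ r, ((w r : ℤ) : ℝ)

variable {T : ℕ}

theorem abs_signSum_le (w : Fin T → ℤˣ) : |signSum w| ≤ T := by
  refine (Finset.abs_sum_le_sum_abs _ _).trans (le_of_eq ?_)
  have (r : Fin T) : |((w r : ℤ) : ℝ)| = 1 := by
    rcases Int.units_eq_one_or (w r) with h | h <;> simp [h]
  simp [this]

theorem sum_exp_mul_signSum_le (t : ℝ) :
    ∑ w : Fin T → ℤˣ, Real.exp (t * signSum w) ≤ 2 ^ T * Real.exp (T * t ^ 2 / 2) := by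
  have h1 : ∑ w : Fin T → ℤˣ, Real.exp (t * signSum w)
      = ∏ _r : Fin T, ∑ u : ℤˣ, Real.exp (t * ((u : ℤ) : ℝ)) := by
    rw [Finset.prod_univ_sum, Fintype.piFinset_univ]
    refine Finset.sum_congr rfl fun w _ => ?_
    rw [signSum, Finset.mul_sum, Real.exp_sum]
  have h2 : ∑ u : ℤˣ, Real.exp (t * ((u : ℤ) : ℝ)) = 2 * Real.cosh t := by
    have : (Finset.univ : Finset ℤˣ) = {1, -1} := rfl
    rw [this, Finset.sum_pair (by decide), Real.cosh_eq]
    simp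
    ring
  rw [h1, h2, Finset.prod_const, Finset.card_univ, Fintype.card_fin, mul_pow]
  gcongr
  calc Real.cosh t ^ T ≤ Real.exp (t ^ 2 / 2) ^ T := by
        exact pow_le_pow_left₀ (Real.cosh_pos t).le (Real.cosh_le_exp_half_sq t) T
    _ = Real.exp (T * t ^ 2 / 2) := by rw [← Real.exp_nat_mul]; ring_nf

theorem integrable_exp_mul_sq_gaussianReal {a : ℝ} (ha : a < 1 / 2) :
    Integrable (fun x => Real.exp (a * x ^ 2)) (gaussianReal 0 1) := by
  rw [gaussianReal_of_var_ne_zero 0 one_ne_zero,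
    integrable_withDensity_iff_integrable_smul' (measurable_gaussianPDF 0 1)
      (ae_of_all _ fun _ => gaussianPDF_lt_top)]
  have : (fun x => (gaussianPDF 0 1 x).toReal • Real.exp (a * x ^ 2))
      = fun x => (√(2 * Real.pi))⁻¹ * Real.exp (-(1 / 2 - a) * x ^ 2) := by
    ext x
    rw [toReal_gaussianPDF, gaussianPDFReal_def, smul_eq_mul, mul_assoc, ← Real.exp_add]
    simp only [NNReal.coe_one, mul_one, sub_zero]
    congr 2
    ring
  rw [this]
  exact (integrable_exp_neg_mul_sq (by linarith)).const_mul _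

/-- The integral equals `(1 - 2a)^{-1/2}`, and `(1 - 2a)(1 + 4a) ≥ 1` for `0 ≤ a ≤ 1/4`. -/
theorem integral_exp_mul_sq_gaussianReal_le {a : ℝ} (ha0 : 0 ≤ a) (ha : a ≤ 1 / 4) :
    ∫ x, Real.exp (a * x ^ 2) ∂gaussianReal 0 1 ≤ Real.exp (2 * a) := by
  rw [integral_gaussianReal_eq_integral_smul one_ne_zero]
  have : (fun x => gaussianPDFReal 0 1 x • Real.exp (a * x ^ 2))
      = fun x => (√(2 * Real.pi))⁻¹ * Real.exp (-(1 / 2 - a) * x ^ 2) := by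
    ext x
    rw [gaussianPDFReal_def, smul_eq_mul, mul_assoc, ← Real.exp_add]
    simp only [NNReal.coe_one, mul_one, sub_zero]
    congr 2
    ring
  rw [this, integral_const_mul, integral_gaussian, ← Real.sqrt_inv,
    ← Real.sqrt_mul (by positivity), Real.sqrt_le_left (Real.exp_pos _).le, ← Real.exp_nat_mul]
  have hpi := Real.pi_pos
  have hpos : 0 < 1 - 2 * a := by linarith
  have h1 : (2 * Real.pi)⁻¹ * (Real.pi / (1 / 2 - a)) = (1 - 2 * a)⁻¹ := by
    have : (1 / 2 - a) ≠ 0 := by linarith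
    field_simp
  rw [h1, inv_le_comm₀ hpos (Real.exp_pos _), ← Real.exp_neg]
  have h2 : 1 + (2 : ℕ) * (2 * a) ≤ Real.exp ((2 : ℕ) * (2 * a)) := by
    linarith [Real.add_one_le_exp ((2 : ℕ) * (2 * a))]
  rw [Real.exp_neg, inv_le_comm₀ (Real.exp_pos _) hpos]
  refine le_trans ?_ h2
  rw [inv_le_iff_one_le_mul₀ hpos]
  push_cast
  nlinarith

/-- Gaussian linearisation: `exp(cA²) = E exp(√(2c) A Z)` with `Z` standard normal reduces the
square to the linear exponential moment under the integral over `Z`. -/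
theorem sum_exp_mul_signSum_sq_le {c : ℝ} (hc : 0 ≤ c) (hcT : c * T ≤ 1 / 4) :
    ∑ w : Fin T → ℤˣ, Real.exp (c * signSum w ^ 2) ≤ 2 ^ T * Real.exp (2 * (c * T)) := by
  have h1 (A : ℝ) : Real.exp (c * A ^ 2)
      = ∫ x, Real.exp ((√(2 * c) * A) * x) ∂gaussianReal 0 1 := by
    have := congrFun (mgf_fun_id_gaussianReal (μ := 0) (v := 1)) (√(2 * c) * A)
    rw [mgf] at this
    rw [this]
    congr 1
    rw [mul_pow, Real.sq_sqrt (by positivity)]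
    simp
    ring
  simp_rw [h1]
  rw [← integral_finsetSum _ fun w _ => integrable_exp_mul_gaussianReal _]
  calc ∫ x, ∑ w : Fin T → ℤˣ, Real.exp ((√(2 * c) * signSum w) * x) ∂gaussianReal 0 1
      ≤ ∫ x, 2 ^ T * Real.exp ((c * T) * x ^ 2) ∂gaussianReal 0 1 := by
        refine integral_mono (integrable_finsetSum _ fun w _ => integrable_exp_mul_gaussianReal _)
          ((integrable_exp_mul_sq_gaussianReal (by linarith)).const_mul _) fun x => ?_
        have := sum_exp_mul_signSum_le (T := T) (√(2 * c) * x)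
        rw [mul_pow, Real.sq_sqrt (by positivity)] at this
        calc _ = ∑ w : Fin T → ℤˣ, Real.exp (√(2 * c) * x * signSum w) := by
              refine Finset.sum_congr rfl fun w _ => ?_
              congr 1; ring
          _ ≤ _ := this
          _ = _ := by congr 2; ring
    _ ≤ _ := by
        rw [integral_const_mul]
        gcongr
        exact integral_exp_mul_sq_gaussianReal_le (by positivity) hcT

theorem inv_one_sub_le_exp {x : ℝ} (hx : |x| ≤ 1 / 2) : (1 - x)⁻¹ ≤ Real.exp (x + x ^ 2) := by
  obtain ⟨h1, h2⟩ := abs_le.1 hx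
  have h3 : 0 < 1 - x := by linarith
  rw [inv_le_iff_one_le_mul₀' h3]
  rcases le_total 0 x with h0 | h0
  · have := Real.quadratic_le_exp_of_nonneg (x := x + x ^ 2) (by positivity)
    refine le_trans ?_ (mul_le_mul_of_nonneg_left this h3.le)
    have : (1 - x) * (1 + (x + x ^ 2) + (x + x ^ 2) ^ 2 / 2)
        = 1 + x ^ 2 / 2 * (1 - x - x ^ 2 - x ^ 3) + 0 := by ring
    have h5 : 0 ≤ 1 - x - x ^ 2 - x ^ 3 := by
      have : x ^ 2 ≤ x / 2 := by nlinarith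
      have : x ^ 3 ≤ x / 4 := by nlinarith
      linarith
    nlinarith [mul_nonneg (sq_nonneg x) h5]
  · have := Real.add_one_le_exp (x + x ^ 2)
    refine le_trans ?_ (mul_le_mul_of_nonneg_left this h3.le)
    nlinarith [mul_nonneg (mul_nonneg (neg_nonneg.2 h0) (neg_nonneg.2 h0)) (neg_nonneg.2 h0)]

/-- After `(1 - x)⁻¹ ≤ exp(x + x²)`, the inequality `2ab ≤ a² + b²` separates the linear and
quadratic exponents so that they can be averaged one at a time. -/
theorem inv_one_sub_pow_le {x : ℝ} (hx : |x| ≤ 1 / 2) (n : ℕ) :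
    ((1 - x)⁻¹) ^ n ≤ (Real.exp (2 * n * x) + Real.exp (2 * n * x ^ 2)) / 2 := by
  have h0 : 0 ≤ (1 - x)⁻¹ := inv_nonneg.2 (by linarith [(abs_le.1 hx).2])
  calc ((1 - x)⁻¹) ^ n ≤ Real.exp (x + x ^ 2) ^ n := pow_le_pow_left₀ h0 (inv_one_sub_le_exp hx) n
    _ = Real.exp (n * x) * Real.exp (n * x ^ 2) := by
        rw [← Real.exp_nat_mul, mul_add, Real.exp_add]
    _ ≤ (Real.exp (n * x) ^ 2 + Real.exp (n * x ^ 2) ^ 2) / 2 := by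
        nlinarith [sq_nonneg (Real.exp (n * x) - Real.exp (n * x ^ 2))]
    _ = _ := by
        rw [← Real.exp_nat_mul, ← Real.exp_nat_mul]
        push_cast
        ring_nf

theorem sum_sum_inv_one_sub_pow_le {n : ℕ} {g : ℝ} (hn : 2 ≤ n) (hg : 0 ≤ g)
    (h1 : g * T ^ 2 ≤ 1 / 2) (h2 : 2 * n ^ 2 * (g * T) ^ 2 ≤ 1 / 4)
    (h3 : 2 * n * (g * T) ^ 2 * T ≤ 1 / 4) :
    ∑ w : Fin T → ℤˣ, ∑ w' : Fin T → ℤˣ, ((1 - g * (signSum w * signSum w'))⁻¹) ^ n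
      ≤ (2 ^ T) ^ 2 * Real.exp (4 * n ^ 2 * (g * T) ^ 2) := by
  have hn' : (2 : ℝ) ≤ n := by exact_mod_cast hn
  -- This uses `n ≥ 2`; it makes the quadratic contribution no larger than the linear one.
  have hnn : 4 * n * (g * T) ^ 2 ≤ 2 * n ^ 2 * (g * T) ^ 2 := by
    have : 4 * (n : ℝ) ≤ 2 * n ^ 2 := by nlinarith
    gcongr
  have hx (w w' : Fin T → ℤˣ) : |g * (signSum w * signSum w')| ≤ 1 / 2 := by
    rw [abs_mul, abs_mul, abs_of_nonneg hg]
    refine le_trans ?_ h1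
    rw [sq]
    gcongr <;> exact abs_signSum_le _
  have hA : ∑ w : Fin T → ℤˣ, ∑ w' : Fin T → ℤˣ,
      Real.exp (2 * n * (g * (signSum w * signSum w')))
      ≤ (2 ^ T) ^ 2 * Real.exp (4 * n ^ 2 * (g * T) ^ 2) := by
    calc _ ≤ ∑ w : Fin T → ℤˣ, 2 ^ T * Real.exp (2 * n ^ 2 * g ^ 2 * T * signSum w ^ 2) := by
          refine Finset.sum_le_sum fun w _ => ?_
          convert sum_exp_mul_signSum_le (T := T) (2 * n * g * signSum w) using 3
          · rfl
          · ring
          · ring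
      _ ≤ 2 ^ T * (2 ^ T * Real.exp (2 * (2 * n ^ 2 * g ^ 2 * T * T))) := by
          rw [← Finset.mul_sum]
          gcongr
          exact sum_exp_mul_signSum_sq_le (by positivity) (by convert h2 using 1; ring)
      _ = _ := by rw [← mul_assoc, ← sq]; congr 2; ring
  -- The squared-sum bound is applied twice: in `w'` with `w` frozen, where `|signSum w| ≤ T` and
  -- `h3` keep the coefficient admissible, and then in `w`.
  have hB : ∑ w : Fin T → ℤˣ, ∑ w' : Fin T → ℤˣ,
      Real.exp (2 * n * (g * (signSum w * signSum w')) ^ 2)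
      ≤ (2 ^ T) ^ 2 * Real.exp (4 * n ^ 2 * (g * T) ^ 2) := by
    calc _ ≤ ∑ w : Fin T → ℤˣ, 2 ^ T * Real.exp (4 * n * g ^ 2 * T * signSum w ^ 2) := by
          refine Finset.sum_le_sum fun w _ => ?_
          have hw : signSum w ^ 2 ≤ (T : ℝ) ^ 2 := by
            rw [← sq_abs]; gcongr; exact abs_signSum_le w
          have hc : 2 * n * g ^ 2 * signSum w ^ 2 * T ≤ 1 / 4 := by
            refine le_trans ?_ h3
            calc 2 * n * g ^ 2 * signSum w ^ 2 * T ≤ 2 * n * g ^ 2 * (T : ℝ) ^ 2 * T := by gcongr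
              _ = _ := by ring
          convert sum_exp_mul_signSum_sq_le (T := T) (by positivity) hc using 3
          · rfl
          · ring
          · ring
      _ ≤ 2 ^ T * (2 ^ T * Real.exp (2 * (4 * n * g ^ 2 * T * T))) := by
          rw [← Finset.mul_sum]
          gcongr
          refine sum_exp_mul_signSum_sq_le (by positivity) ?_
          refine le_trans (le_of_eq ?_) (hnn.trans h2)
          ring
      _ ≤ _ := by
          rw [← mul_assoc, ← sq]
          refine mul_le_mul_of_nonneg_left (Real.exp_le_exp.2 ?_) (by positivity)
          linarith
  calc _ ≤ ∑ w : Fin T → ℤˣ, ∑ w' : Fin T → ℤˣ,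
        (Real.exp (2 * n * (g * (signSum w * signSum w')))
          + Real.exp (2 * n * (g * (signSum w * signSum w')) ^ 2)) / 2 :=
        Finset.sum_le_sum fun w _ => Finset.sum_le_sum fun w' _ => inv_one_sub_pow_le (hx w w') n
    _ = ((∑ w : Fin T → ℤˣ, ∑ w' : Fin T → ℤˣ,
          Real.exp (2 * n * (g * (signSum w * signSum w'))))
        + ∑ w : Fin T → ℤˣ, ∑ w' : Fin T → ℤˣ,
          Real.exp (2 * n * (g * (signSum w * signSum w')) ^ 2)) / 2 := by
        simp_rw [← Finset.sum_div, Finset.sum_add_distrib]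
    _ ≤ _ := by linarith

end SignSums

/-! ### Second moment of the mixture over sign patterns -/

namespace InverseCovarianceTest

open Matrix

theorem sum_sum_det_signPattern_le {B T p n : ℕ} {h : 2 * T * B ≤ p} {τ : ℝ} (hT : T ≠ 0)
    (hn : 2 ≤ n) (h1 : τ ^ 2 ≤ 1 / 2) (h2 : 2 * n ^ 2 * (τ ^ 2 / T) ^ 2 ≤ 1 / 4)
    (h3 : 2 * n * (τ ^ 2 / T) ^ 2 * T ≤ 1 / 4) :
    ∑ s : Fin B → Bool → Fin T → ℤˣ, ∑ s' : Fin B → Bool → Fin T → ℤˣ,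
      ((√((1 + τ • signPattern h s) + (1 + τ • signPattern h s')
        - (1 + τ • signPattern h s) * (1 + τ • signPattern h s')).det)⁻¹) ^ n
      ≤ (Fintype.card (Fin B → Bool → Fin T → ℤˣ) : ℝ) ^ 2
        * Real.exp (4 * n ^ 2 * (τ ^ 2 / T) ^ 2 * B) := by
  have hT' : (T : ℝ) ≠ 0 := by exact_mod_cast hT
  set g : ℝ := τ ^ 2 / T ^ 2 with hg
  have hgT : g * T = τ ^ 2 / T := by rw [hg]; field_simp
  set f : (Bool → Fin T → ℤˣ) → ℝ := fun w =>
    ((1 - g * (signSum (w true) * signSum (w false)))⁻¹) ^ n with hf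
  have hx (w w' : Fin T → ℤˣ) : 0 ≤ 1 - g * (signSum w * signSum w') := by
    have : |g * (signSum w * signSum w')| ≤ 1 / 2 := by
      rw [abs_mul, abs_mul, abs_of_nonneg (by positivity : 0 ≤ g)]
      refine le_trans ?_ h1
      calc g * (|signSum w| * |signSum w'|) ≤ g * (T * T) := by
            gcongr <;> exact abs_signSum_le _
        _ = τ ^ 2 := by rw [hg]; field_simp
    linarith [(abs_le.1 this).2]
  have hterm (s s' : Fin B → Bool → Fin T → ℤˣ) :
      ((√((1 + τ • signPattern h s) + (1 + τ • signPattern h s')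
        - (1 + τ • signPattern h s) * (1 + τ • signPattern h s')).det)⁻¹) ^ n
      = ∏ b, f ((s * s') b) := by
    have hfac (b : Fin B) : 1 - τ ^ 2 * ∏ c, ((∑ r, (((s * s') b c r : ℤˣ) : ℤ) : ℝ) / T)
        = 1 - g * (signSum ((s * s') b true) * signSum ((s * s') b false)) := by
      rw [Fintype.prod_bool, hg]
      unfold signSum
      field_simp
    rw [det_signPattern]
    simp_rw [hfac]
    rw [Real.sqrt_sq (Finset.prod_nonneg fun b _ => hx _ _), ← Finset.prod_inv_distrib,
      ← Finset.prod_pow]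
  have hblock : ∑ w, f w ≤ (2 ^ T) ^ 2 * Real.exp (4 * n ^ 2 * (τ ^ 2 / T) ^ 2) := by
    rw [← hgT] at h2 h3 ⊢
    refine le_trans (le_of_eq ?_) (sum_sum_inv_one_sub_pow_le (T := T) hn (by positivity)
      (by rw [hg]; field_simp; linarith) h2 h3)
    rw [← Fintype.sum_prod_type']
    exact Fintype.sum_equiv (Equiv.boolArrowEquivProd _) _ _ fun w => by
      simp [hf, Equiv.boolArrowEquivProd, mul_comm]
  have hcard : (Fintype.card (Fin B → Bool → Fin T → ℤˣ) : ℝ) = ((2 ^ T) ^ 2) ^ B := by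
    simp [Fintype.card_units_int]
  simp_rw [hterm]
  -- The summand depends only on `s * s'`. Translation in the group of signs makes the inner sum
  -- independent of `s`, after which it factorises over blocks.
  calc _ = ∑ _s : Fin B → Bool → Fin T → ℤˣ, ∑ w : Fin B → Bool → Fin T → ℤˣ, ∏ b, f (w b) := by
        refine Finset.sum_congr rfl fun s _ => ?_
        exact Fintype.sum_equiv (Equiv.mulLeft s) _ _ fun s' => rfl
    _ = (Fintype.card (Fin B → Bool → Fin T → ℤˣ) : ℝ) * (∑ w, f w) ^ B := by
        rw [Finset.sum_const, Finset.card_univ, nsmul_eq_mul]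
        congr 1
        have := Finset.prod_univ_sum (fun _ : Fin B => (Finset.univ : Finset (Bool → Fin T → ℤˣ)))
          fun _ w => f w
        rw [Fintype.piFinset_univ, Finset.prod_const, Finset.card_univ, Fintype.card_fin] at this
        exact this.symm
    _ ≤ (Fintype.card (Fin B → Bool → Fin T → ℤˣ) : ℝ)
        * ((2 ^ T) ^ 2 * Real.exp (4 * n ^ 2 * (τ ^ 2 / T) ^ 2)) ^ B := by
        gcongr
        exact Finset.sum_nonneg fun w _ => pow_nonneg (inv_nonneg.2 (hx _ _)) n
    _ = _ := by
        rw [mul_pow, ← Real.exp_nat_mul, hcard, sq (((2 ^ T) ^ 2) ^ B : ℝ), ← mul_assoc]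
        ring_nf

theorem ofReal_one_sub_le_minimaxError_altInverse {α L lam ψ τ δ : ℝ} {B T p n : ℕ}
    (h : 2 * T * B ≤ p) (hT : T ≠ 0) (hn : 2 ≤ n) (hp : 0 < p) (hα : 0 ≤ α) (hτ : 0 ≤ τ)
    (hτ1 : τ ≤ 1 / 3) (hlam : lam ≤ 1 - τ)
    (hL : 2 * B * τ ^ 2 * (2 * T : ℝ) ^ (2 * α) ≤ p * L) (hψ : p * ψ ^ 2 ≤ B * τ ^ 2)
    (h2 : 2 * n ^ 2 * (τ ^ 2 / T) ^ 2 ≤ 1 / 4) (h3 : 2 * n * (τ ^ 2 / T) ^ 2 * T ≤ 1 / 4)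
    (hδ : 0 < δ) (hexp : Real.exp (4 * n ^ 2 * (τ ^ 2 / T) ^ 2 * B) ≤ 1 + δ ^ 2) :
    ENNReal.ofReal (1 - δ)
      ≤ minimaxError n p (nullInverse p) (altInverse α L lam p ψ) := by
  refine ofReal_one_sub_le_minimaxError (Ω := Fin B → Bool → Fin T → ℤˣ)
    (show 1 ∈ nullInverse p from ⟨PosSemidef.one, inv_one⟩) (fun s => 1 + τ • signPattern h s)
    (fun s => one_add_smul_signPattern_mem_altInverse hT hα hτ (by linarith) hlam hL hψ hp)
    (fun s => posDef_one_add_smul signPattern_transpose (signPattern_tripotent hT) hτ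
      (by linarith))
    (fun s s' => posDef_inv_add_inv_sub_one signPattern_transpose (signPattern_tripotent hT)
      signPattern_transpose (signPattern_tripotent hT) hτ hτ1) hδ ?_
  refine (sum_sum_det_signPattern_le hT hn (by nlinarith) h2 h3).trans ?_
  gcongr

end InverseCovarianceTest

/-! ### The bandwidth and its asymptotics -/

namespace InverseCovarianceTest

/-- The order of magnitude of the optimal bandwidth. -/
noncomputable def bandwidth (α : ℝ) (n p : ℕ) : ℝ := ((n : ℝ) * √p) ^ (2 / (4 * α + 1))

section Bandwidth

variable {α L : ℝ} {n p : ℕ → ℕ}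

theorem bandwidth_rpow (hα : 0 < α) (n p : ℕ) :
    bandwidth α n p ^ (4 * α + 1) = (n : ℝ) ^ 2 * p := by
  unfold bandwidth
  rw [← Real.rpow_mul (by positivity), div_mul_cancel₀ _ (by positivity), Real.rpow_ofNat,
    mul_pow, Real.sq_sqrt (Nat.cast_nonneg p)]

theorem constC_pos (hα : 0 < α) (hL : 0 < L) : 0 < constC α L := by
  unfold constC; positivity

theorem separationRate_eq (hα : 0 < α) (hL : 0 < L) (n p : ℕ) :
    separationRate α L n p
      = (constC α L ^ (1 / 2 : ℝ)) ^ (-(2 * α / (4 * α + 1))) * bandwidth α n p ^ (-α) := by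
  have hC := constC_pos hα hL
  have hexp : (((n : ℝ) * √p) ^ (2 / (4 * α + 1))) ^ (-α)
      = ((n : ℝ) * √p) ^ (-(2 * α / (4 * α + 1))) := by
    rw [← Real.rpow_mul (by positivity)]
    congr 1
    ring
  unfold separationRate bandwidth
  rw [Real.mul_rpow (by positivity) (by positivity), mul_comm, hexp]

theorem tendsto_bandwidth (hα : 0 < α) (hn : Tendsto n atTop atTop) (hp : Tendsto p atTop atTop) :
    Tendsto (fun k => bandwidth α (n k) (p k)) atTop atTop := by
  refine (tendsto_rpow_atTop (by positivity)).comp ?_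
  refine (tendsto_natCast_atTop_atTop.comp hn).atTop_mul_atTop₀ ?_
  exact Real.tendsto_sqrt_atTop.comp (tendsto_natCast_atTop_atTop.comp hp)

/-- The quotient is exactly `(n / p^{2α})^{2/(4α+1)}`. -/
theorem tendsto_bandwidth_div (hα : 0 < α) (hp : Tendsto p atTop atTop)
    (hnp : (fun k => (n k : ℝ)) =o[atTop] (fun k => (p k : ℝ) ^ (2 * α))) :
    Tendsto (fun k => bandwidth α (n k) (p k) / p k) atTop (𝓝 0) := by
  have h1 := hnp.tendsto_div_nhds_zero
  have h2 : Tendsto (fun k => ((n k : ℝ) / (p k : ℝ) ^ (2 * α)) ^ (2 / (4 * α + 1))) atTop (𝓝 0) := by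
    have := h1.rpow_const (p := 2 / (4 * α + 1)) (Or.inr (by positivity))
    rwa [Real.zero_rpow (by positivity)] at this
  refine h2.congr' ?_
  filter_upwards [hp.eventually_gt_atTop 0] with k hk
  have hk' : (0 : ℝ) < p k := by exact_mod_cast hk
  unfold bandwidth
  rw [Real.div_rpow (by positivity) (by positivity), Real.mul_rpow (by positivity) (by positivity),
    Real.sqrt_eq_rpow, ← Real.rpow_mul hk'.le, ← Real.rpow_mul hk'.le, mul_div_assoc, div_eq_mul_inv,
    ← Real.rpow_neg hk'.le]
  nth_rewrite 3 [← Real.rpow_one (p k : ℝ)]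
  rw [← Real.rpow_sub hk']
  congr 2
  field_simp
  ring

end Bandwidth

/-! ### Choice of parameters and the lower bound -/

section LowerBound

variable {α L lam ψ y q : ℝ} {n p : ℕ}

theorem ofReal_one_sub_sqrt_le_minimaxError (hα : 1 / 2 ≤ α) (hlam : lam < 1) (hn : 2 ≤ n)
    (hy1 : 1 ≤ y) (hy : y ^ (4 * α + 1) = (n : ℝ) ^ 2 * p) (hyp : 4 * y ≤ p) (hψ : 0 < ψ)
    (hq : q = ψ * y ^ α) (hqL : 4 * 4 ^ (2 * α) * q ^ 2 ≤ L) (hq3 : 8 * q ^ 2 ≤ (1 / 3) ^ 2)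
    (hqlam : 8 * q ^ 2 ≤ (1 - lam) ^ 2) :
    ENNReal.ofReal (1 - √(Real.exp (32 * q ^ 4) - 1))
      ≤ minimaxError n p (nullInverse p) (altInverse α L lam p ψ) := by
  have hy0 : 0 < y := by linarith
  have hp0 : (0 : ℝ) < p := by linarith
  have hq0 : 0 < q := by rw [hq]; positivity
  have hn' : (2 : ℝ) ≤ n := by exact_mod_cast hn
  -- Now `y ≤ T ≤ 2y`, and `4y ≤ p` leaves room for at least one block, hence `p < 2T(B + 1) ≤ 4TB`.
  set T := ⌈y⌉₊ with hTdef
  have hTy : y ≤ T := Nat.le_ceil y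
  have hT2 : (T : ℝ) ≤ 2 * y := by
    have := Nat.ceil_lt_add_one hy0.le
    linarith
  have hT0 : (0 : ℝ) < T := by linarith
  have hTne : T ≠ 0 := by
    intro h; rw [h] at hT0; simp at hT0
  set B := p / (2 * T) with hBdef
  have hB : 2 * T * B ≤ p := Nat.mul_div_le _ _
  have hB' : 2 * T * (B : ℝ) ≤ p := by exact_mod_cast hB
  have hB1 : 1 ≤ B := by
    rw [hBdef, Nat.one_le_div_iff (by omega)]
    have : 2 * (T : ℝ) ≤ p := by linarith
    exact_mod_cast this
  have hBlow : (p : ℝ) ≤ 4 * T * B := by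
    have h1 : p < 2 * T * (B + 1) := Nat.lt_mul_div_succ p (by omega)
    have h2 : (p : ℝ) < 2 * T * (B + 1) := by exact_mod_cast h1
    have h3 : (1 : ℝ) ≤ B := by exact_mod_cast hB1
    nlinarith
  -- Chosen so that `p ≤ 4TB` gives the separation `pψ² ≤ Bτ²`. Then `τ²/T = 4ψ²`, and `τ² ≤ 8q²`
  -- because `y ≤ y^{2α}`.
  set τ := √(4 * T * ψ ^ 2) with hτdef
  have hτ2 : τ ^ 2 = 4 * T * ψ ^ 2 := Real.sq_sqrt (by positivity)
  have hyα : y ^ (2 * α) = (y ^ α) ^ 2 := by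
    rw [← Real.rpow_natCast, ← Real.rpow_mul hy0.le]; congr 1; push_cast; ring
  have hq2 : q ^ 2 = ψ ^ 2 * y ^ (2 * α) := by rw [hq, mul_pow, hyα]
  have hyle : y ≤ y ^ (2 * α) := by
    conv_lhs => rw [← Real.rpow_one y]
    exact Real.rpow_le_rpow_of_exponent_le hy1 (by linarith)
  have hψT : ψ ^ 2 * T ≤ 2 * q ^ 2 := by
    rw [hq2]
    calc ψ ^ 2 * T ≤ ψ ^ 2 * (2 * y ^ (2 * α)) := by gcongr; linarith
      _ = _ := by ring
  have hτq : τ ^ 2 ≤ 8 * q ^ 2 := by rw [hτ2]; linarith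
  -- The defining equation of the bandwidth: it turns the exponent `4n²(τ²/T)²B` into at most
  -- `32q⁴`.
  have hkey : (n : ℝ) ^ 2 * ψ ^ 4 * p = q ^ 4 * y := by
    have h4 : y ^ (4 * α + 1) = (y ^ α) ^ 4 * y := by
      rw [Real.rpow_add hy0, Real.rpow_one, ← Real.rpow_natCast (y ^ α), ← Real.rpow_mul hy0.le]
      congr 2; push_cast; ring
    rw [hq, mul_pow, mul_assoc (ψ ^ 4), ← h4, hy]; ring
  have hnψ : (n * ψ ^ 2) ^ 2 ≤ (q ^ 2) ^ 2 := by
    have h1 : (n : ℝ) ^ 2 * ψ ^ 4 * y ≤ (n : ℝ) ^ 2 * ψ ^ 4 * p := by gcongr; linarith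
    rw [hkey] at h1
    have := le_of_mul_le_mul_right h1 hy0
    linarith
  have hnψ' : n * ψ ^ 2 ≤ q ^ 2 := le_of_sq_le_sq hnψ (by positivity)
  have hh : τ ^ 2 / T = 4 * ψ ^ 2 := by rw [hτ2]; field_simp
  have hq2s : q ^ 2 ≤ 1 / 72 := by linarith
  have hq4s : q ^ 2 * q ^ 2 ≤ 1 / 72 * (1 / 72) := by gcongr
  refine ofReal_one_sub_le_minimaxError_altInverse (τ := τ) hB hTne hn (by exact_mod_cast hp0)
    (by linarith) (Real.sqrt_nonneg _) (le_of_sq_le_sq (hτq.trans hq3) (by norm_num))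
    ?_ ?_ ?_ ?_ ?_ ?_ ?_
  · have := le_of_sq_le_sq (hτq.trans hqlam) (by linarith)
    linarith
  · have hpow : (2 * T : ℝ) ^ (2 * α) ≤ 4 ^ (2 * α) * y ^ (2 * α) := by
      rw [← Real.mul_rpow (by norm_num) hy0.le]
      exact Real.rpow_le_rpow (by positivity) (by linarith) (by linarith)
    calc 2 * B * τ ^ 2 * (2 * T : ℝ) ^ (2 * α)
        = 4 * (2 * T * B) * ψ ^ 2 * (2 * T : ℝ) ^ (2 * α) := by rw [hτ2]; ring
      _ ≤ 4 * p * ψ ^ 2 * (4 ^ (2 * α) * y ^ (2 * α)) := by gcongr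
      _ = p * (4 * 4 ^ (2 * α) * q ^ 2) := by rw [hq2]; ring
      _ ≤ _ := by gcongr
  · rw [hτ2]
    calc (p : ℝ) * ψ ^ 2 ≤ 4 * T * B * ψ ^ 2 := by gcongr
      _ = _ := by ring
  · rw [hh]
    nlinarith
  · rw [hh]
    calc 2 * n * (4 * ψ ^ 2) ^ 2 * T = 32 * (n * ψ ^ 2) * (ψ ^ 2 * T) := by ring
      _ ≤ 32 * q ^ 2 * (2 * q ^ 2) := by gcongr
      _ ≤ _ := by linarith
  · rw [Real.sqrt_pos, sub_pos, Real.one_lt_exp_iff]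
    positivity
  · have hnn : 0 ≤ Real.exp (32 * q ^ 4) - 1 := sub_nonneg.2 (Real.one_le_exp (by positivity))
    rw [hh, Real.sq_sqrt hnn, add_sub_cancel, Real.exp_le_exp]
    refine le_of_mul_le_mul_right ?_ hy0
    calc 4 * n ^ 2 * (4 * ψ ^ 2) ^ 2 * B * y ≤ 4 * n ^ 2 * (4 * ψ ^ 2) ^ 2 * B * T := by gcongr
      _ = 32 * (n ^ 2 * ψ ^ 4 * (2 * T * B)) := by ring
      _ ≤ 32 * (n ^ 2 * ψ ^ 4 * p) := by gcongr
      _ = _ := by rw [hkey]; ring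

end LowerBound

theorem tendsto_minimaxError_one {α L lam : ℝ} (hα : 1 / 2 ≤ α) (hL : 0 < L) (hlam : lam < 1)
    {n p : ℕ → ℕ} (hn : Tendsto n atTop atTop) (hp : Tendsto p atTop atTop)
    (hnp : (fun k => (n k : ℝ)) =o[atTop] (fun k => (p k : ℝ) ^ (2 * α))) {ψ : ℕ → ℝ}
    (hψ : ∀ k, 0 < ψ k)
    (hq : Tendsto (fun k => ψ k * bandwidth α (n k) (p k) ^ α) atTop (𝓝 0)) :
    Tendsto (fun k => minimaxError (n k) (p k) (nullInverse (p k)) (altInverse α L lam (p k) (ψ k)))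
      atTop (𝓝 1) := by
  have hα0 : 0 < α := by linarith
  set q := fun k => ψ k * bandwidth α (n k) (p k) ^ α with hqdef
  have hsq (c : ℝ) : Tendsto (fun k => c * q k ^ 2) atTop (𝓝 0) := by
    simpa using (hq.pow 2).const_mul c
  have hlow : Tendsto (fun k => ENNReal.ofReal (1 - √(Real.exp (32 * q k ^ 4) - 1)))
      atTop (𝓝 1) := by
    have h1 : Continuous fun x : ℝ => 1 - √(Real.exp (32 * x ^ 4) - 1) := by fun_prop
    have := ENNReal.tendsto_ofReal ((h1.tendsto 0).comp hq)
    simpa [Function.comp_def] using this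
  refine tendsto_of_tendsto_of_tendsto_of_le_of_le' hlow tendsto_const_nhds ?_
    (Eventually.of_forall fun k => minimaxError_le_one _ _)
  filter_upwards [hn.eventually_ge_atTop 2,
    (tendsto_bandwidth hα0 hn hp).eventually_ge_atTop 1, hp.eventually_gt_atTop 0,
    (tendsto_bandwidth_div hα0 hp hnp).eventually_le_const (show (0 : ℝ) < 1 / 4 by norm_num),
    (hsq (4 * 4 ^ (2 * α))).eventually_le_const hL,
    (hsq 8).eventually_le_const (show (0 : ℝ) < (1 / 3) ^ 2 by norm_num),
    (hsq 8).eventually_le_const (show (0 : ℝ) < (1 - lam) ^ 2 by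
      have : 0 < 1 - lam := by linarith
      positivity)] with k h1 h2 h3 h4 h5 h6 h7
  have hpk : (0 : ℝ) < p k := by exact_mod_cast h3
  rw [div_le_iff₀ hpk] at h4
  exact ofReal_one_sub_sqrt_le_minimaxError hα hlam h1 h2 (bandwidth_rpow hα0 _ _)
    (by linarith) (hψ k) rfl h5 h6 h7

end InverseCovarianceTest

/-! ### Second and fourth moments of Gaussian vectors -/

section FourthMoments

theorem integral_pow_four_gaussianReal (v : ℝ≥0) :
    ∫ x, x ^ 4 ∂gaussianReal 0 v = 3 * (v : ℝ) ^ 2 := by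
  have h0 := iteratedDeriv_mgf_zero (X := fun x : ℝ => x) (μ := gaussianReal 0 v)
    (by rw [integrableExpSet_fun_id_gaussianReal]; simp) 4
  simp only [Pi.pow_apply] at h0
  rw [← h0, mgf_fun_id_gaussianReal]
  simp only [zero_mul, zero_add]
  have hE (t : ℝ) : HasDerivAt (fun t : ℝ => Real.exp (v * t ^ 2 / 2))
      (Real.exp (v * t ^ 2 / 2) * (v * t)) t := by
    have := (((hasDerivAt_pow 2 t).const_mul (v : ℝ)).div_const 2).exp
    convert this using 1
    push_cast
    ring
  -- Differentiation preserves the form polynomial times `exp(vt²/2)`, so the fourth derivative of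
  -- the moment generating function is four rounds of polynomial algebra.
  have hstep (P : Polynomial ℝ) :
      deriv (fun t => P.eval t * Real.exp (v * t ^ 2 / 2))
        = fun t => (Polynomial.derivative P + P * (Polynomial.C (v : ℝ) * Polynomial.X)).eval t
          * Real.exp (v * t ^ 2 / 2) := by
    funext t
    refine ((P.hasDerivAt t).fun_mul (hE t)).deriv.trans ?_
    simp
    ring
  have e0 : (fun t : ℝ => Real.exp (v * t ^ 2 / 2))
      = fun t => (1 : Polynomial ℝ).eval t * Real.exp (v * t ^ 2 / 2) := by simp
  rw [iteratedDeriv_eq_iterate]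
  simp only [Function.iterate_succ, Function.iterate_zero, Function.comp, id]
  rw [e0, hstep, hstep, hstep, hstep]
  simp
  ring

open Matrix
variable {ι : Type*} [Fintype ι] [DecidableEq ι] {S : Matrix ι ι ℝ}

theorem memLp_inner_multivariateGaussian (t : EuclideanSpace ℝ ι) (q : ℝ≥0) :
    MemLp (fun x => inner ℝ t x) q (multivariateGaussian 0 S) := by
  exact (IsGaussian.memLp_dual (multivariateGaussian 0 S) (innerSL ℝ t) q (by simp))

theorem integral_inner_pow_four_multivariateGaussian (hS : S.PosSemidef)
    (t : EuclideanSpace ℝ ι) :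
    ∫ x, (inner ℝ t x) ^ 4 ∂multivariateGaussian 0 S = 3 * (t ⬝ᵥ S *ᵥ t) ^ 2 := by
  have hvar : Var[innerSL ℝ t; multivariateGaussian 0 S] = t ⬝ᵥ S *ᵥ t :=
    (covarianceBilin_self IsGaussian.memLp_two_id t).symm.trans
      (covarianceBilin_multivariateGaussian hS t t)
  have hmap : (multivariateGaussian 0 S).map (innerSL ℝ t)
      = gaussianReal 0 (t ⬝ᵥ S *ᵥ t).toNNReal := by
    rw [IsGaussian.map_eq_gaussianReal, (innerSL ℝ t).integral_comp_id_comm IsGaussian.integrable_id,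
      integral_id_multivariateGaussian, map_zero,
      hvar]
  have := integral_map (μ := multivariateGaussian 0 S) (φ := innerSL ℝ t) (f := fun x : ℝ => x ^ 4)
    (by fun_prop) (by fun_prop)
  rw [hmap, integral_pow_four_gaussianReal] at this
  simp only [innerSL_apply_apply] at this
  rw [← this, Real.coe_toNNReal]
  simpa using hS.dotProduct_mulVec_nonneg t

theorem integrable_inner_pow_four_multivariateGaussian (t : EuclideanSpace ℝ ι) :
    Integrable (fun x => (inner ℝ t x) ^ 4) (multivariateGaussian 0 S) := by
  have := (memLp_inner_multivariateGaussian (S := S) t 4).integrable_norm_pow (by norm_num)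
  refine this.congr (ae_of_all _ fun x => ?_)
  simp only [Real.norm_eq_abs]
  exact Even.pow_abs (by decide) _

/-- The linear combination `eᵢ + a eⱼ + b eₖ + c eₗ` of coordinate vectors. -/
def coordComb (i j k l : ι) (a b c : ℝ) : EuclideanSpace ℝ ι :=
  WithLp.toLp 2 (Pi.single i 1 + a • Pi.single j 1 + b • Pi.single k 1 + c • Pi.single l 1)

theorem inner_coordComb (i j k l : ι) (a b c : ℝ) (x : EuclideanSpace ℝ ι) :
    inner ℝ (coordComb i j k l a b c) x = x i + a * x j + b * x k + c * x l := by
  rw [EuclideanSpace.inner_eq_star_dotProduct, coordComb]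
  simp [dotProduct_add, dotProduct_smul]

theorem dotProduct_mulVec_coordComb (hS : Sᵀ = S) (i j k l : ι) (a b c : ℝ) :
    coordComb i j k l a b c ⬝ᵥ S *ᵥ coordComb i j k l a b c
      = S i i + a ^ 2 * S j j + b ^ 2 * S k k + c ^ 2 * S l l + 2 * (a * S i j + b * S i k
        + c * S i l + a * b * S j k + a * c * S j l + b * c * S k l) := by
  have h (u v : ι) : S u v = S v u := congrFun (congrFun hS.symm u) v
  simp only [coordComb, mulVec_add, mulVec_smul, add_dotProduct, dotProduct_add, smul_dotProduct,
    dotProduct_smul, single_dotProduct, mulVec_single, smul_eq_mul, one_mul,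
    MulOpposite.op_one, one_smul, col_apply]
  rw [h j i, h k i, h l i, h k j, h l j, h l k]
  ring

/-- Signed summation over the eight choices of signs keeps only the monomial `xyzw`, with
coefficient `8 · 4! = 192`. Mixed fourth moments thus follow from those of linear forms. -/
theorem polarization_four (x y z w : ℝ) :
    x * y * z * w = 192⁻¹ * (((x + 1 * y + 1 * z + 1 * w) ^ 4 - (x + 1 * y + 1 * z + (-1) * w) ^ 4
      - (x + 1 * y + (-1) * z + 1 * w) ^ 4 + (x + 1 * y + (-1) * z + (-1) * w) ^ 4)
      - ((x + (-1) * y + 1 * z + 1 * w) ^ 4 - (x + (-1) * y + 1 * z + (-1) * w) ^ 4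
      - (x + (-1) * y + (-1) * z + 1 * w) ^ 4 + (x + (-1) * y + (-1) * z + (-1) * w) ^ 4)) := by
  ring

theorem integrable_mul_four_multivariateGaussian (i j k l : ι) :
    Integrable (fun x : EuclideanSpace ℝ ι => x i * x j * x k * x l)
      (multivariateGaussian 0 S) := by
  have h (a b c : ℝ) := integrable_inner_pow_four_multivariateGaussian (S := S)
    (coordComb i j k l a b c)
  simp only [inner_coordComb] at h
  simp_rw [polarization_four]
  exact ((((h 1 1 1).sub (h 1 1 (-1))).sub (h 1 (-1) 1)).add (h 1 (-1) (-1))).sub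
    ((((h (-1) 1 1).sub (h (-1) 1 (-1))).sub (h (-1) (-1) 1)).add (h (-1) (-1) (-1))) |>.const_mul _

/-- **Isserlis' formula** for fourth moments. -/
theorem integral_mul_four_multivariateGaussian (hS : S.PosSemidef) (i j k l : ι) :
    ∫ x : EuclideanSpace ℝ ι, x i * x j * x k * x l ∂multivariateGaussian 0 S
      = S i j * S k l + S i k * S j l + S i l * S j k := by
  have hSt : Sᵀ = S := by simpa using hS.isHermitian.eq
  have h (a b c : ℝ) := integrable_inner_pow_four_multivariateGaussian (S := S)
    (coordComb i j k l a b c)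
  have hI (a b c : ℝ) := integral_inner_pow_four_multivariateGaussian hS (coordComb i j k l a b c)
  simp only [inner_coordComb, dotProduct_mulVec_coordComb hSt] at h hI
  simp_rw [polarization_four]
  rw [integral_const_mul, integral_sub, integral_add, integral_sub, integral_sub, integral_add,
    integral_sub, integral_sub]
  · simp only [hI]
    ring
  all_goals first
    | exact h _ _ _
    | exact (h _ _ _).sub (h _ _ _)
    | exact ((h _ _ _).sub (h _ _ _)).sub (h _ _ _)
    | exact (((h _ _ _).sub (h _ _ _)).sub (h _ _ _)).add (h _ _ _)

theorem integrable_mul_multivariateGaussian (i j : ι) :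
    Integrable (fun x : EuclideanSpace ℝ ι => x i * x j) (multivariateGaussian 0 S) := by
  have h (i : ι) : MemLp (fun x : EuclideanSpace ℝ ι => x i) 2 (multivariateGaussian 0 S) :=
    IsGaussian.memLp_dual _ (EuclideanSpace.proj i) 2 (by simp)
  exact (h i).integrable_mul (h j)

theorem integral_mul_multivariateGaussian (hS : S.PosSemidef) (i j : ι) :
    ∫ x : EuclideanSpace ℝ ι, x i * x j ∂multivariateGaussian 0 S = S i j := by
  have h (i : ι) : MemLp (fun x : EuclideanSpace ℝ ι => x i) 2 (multivariateGaussian 0 S) :=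
    IsGaussian.memLp_dual _ (EuclideanSpace.proj i) 2 (by simp)
  have h0 (i : ι) : ∫ x : EuclideanSpace ℝ ι, x i ∂multivariateGaussian 0 S = 0 := by
    have := (EuclideanSpace.proj (𝕜 := ℝ) i).integral_comp_id_comm
      (μ := multivariateGaussian 0 S) IsGaussian.integrable_id
    simpa using this
  have := covariance_eq_sub (h i) (h j)
  rw [covariance_eval_multivariateGaussian hS, h0, h0] at this
  simpa using this.symm

end FourthMoments

/-! ### Mean and variance of the split-sample statistic -/

section SplitSample

variable {E κ : Type*} {n : ℕ}

/-- The average of `f` over the observations with index in `A`. -/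
noncomputable def sampleAvg (f : E → ℝ) (A : Finset (Fin n)) (x : Fin n → E) : ℝ :=
  (∑ a ∈ A, f (x a)) / A.card

/-- The split-sample statistic: the inner product of the averages over two sets of observations. -/
noncomputable def splitStat [Fintype κ] (f : κ → E → ℝ) (A B : Finset (Fin n))
    (x : Fin n → E) : ℝ :=
  ∑ q, sampleAvg (f q) A x * sampleAvg (f q) B x

theorem sampleAvg_mul_sampleAvg (f g : E → ℝ) (A : Finset (Fin n)) (x : Fin n → E) :
    sampleAvg f A x * sampleAvg g A x
      = (∑ a ∈ A, ∑ b ∈ A, f (x a) * g (x b)) / (A.card : ℝ) ^ 2 := by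
  rw [sampleAvg, sampleAvg, div_mul_div_comm, Finset.sum_mul_sum, sq]

theorem splitStat_sq [Fintype κ] (f : κ → E → ℝ) (A B : Finset (Fin n)) (x : Fin n → E) :
    splitStat f A B x ^ 2 = ∑ q, ∑ r, (sampleAvg (f q) A x * sampleAvg (f r) A x)
      * (sampleAvg (f q) B x * sampleAvg (f r) B x) := by
  rw [splitStat, sq, Finset.sum_mul_sum]
  exact Finset.sum_congr rfl fun q _ => Finset.sum_congr rfl fun r _ => by ring

variable [MeasurableSpace E] {ν : Measure E} [IsProbabilityMeasure ν] {f g : E → ℝ}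

theorem measurable_sampleAvg (hf : Measurable f) (A : Finset (Fin n)) :
    Measurable (sampleAvg f A) := by
  unfold sampleAvg
  exact (Finset.measurable_sum _ fun a _ => hf.comp (measurable_pi_apply a)).div_const _

theorem integrable_comp_eval_pi (hf : Integrable f ν) (a : Fin n) :
    Integrable (fun x : Fin n → E => f (x a)) (Measure.pi fun _ => ν) :=
  (measurePreserving_eval (fun _ : Fin n => ν) a).integrable_comp_of_integrable hf

theorem integral_comp_eval_pi (hf : Measurable f) (a : Fin n) :
    ∫ x : Fin n → E, f (x a) ∂(Measure.pi fun _ => ν) = ∫ y, f y ∂ν := by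
  have := (measurePreserving_eval (fun _ : Fin n => ν) a)
  have h := integral_map (μ := Measure.pi fun _ : Fin n => ν) this.measurable.aemeasurable
    (f := f) hf.aestronglyMeasurable
  rw [this.map_eq] at h
  exact h.symm

theorem indepFun_comp_eval_pi (hf : Measurable f) (hg : Measurable g) {a b : Fin n}
    (hab : a ≠ b) : IndepFun (fun x : Fin n → E => f (x a)) (fun x => g (x b))
      (Measure.pi fun _ => ν) := by
  have := (iIndepFun_pi (μ := fun _ : Fin n => ν) (X := fun _ y => y)
    fun _ => aemeasurable_id).indepFun hab
  exact this.comp hf hg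

theorem integrable_eval_mul_eval_pi (hf : Measurable f) (hg : Measurable g) (hfi : Integrable f ν)
    (hgi : Integrable g ν) (hfg : Integrable (fun y => f y * g y) ν) (a b : Fin n) :
    Integrable (fun x : Fin n → E => f (x a) * g (x b)) (Measure.pi fun _ => ν) := by
  rcases eq_or_ne a b with rfl | hab
  · exact integrable_comp_eval_pi hfg a
  · exact (indepFun_comp_eval_pi hf hg hab).integrable_mul (integrable_comp_eval_pi hfi a)
      (integrable_comp_eval_pi hgi b)

theorem integral_eval_mul_eval_pi (hf : Measurable f) (hg : Measurable g) (a b : Fin n) :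
    ∫ x : Fin n → E, f (x a) * g (x b) ∂(Measure.pi fun _ => ν)
      = (∫ y, f y ∂ν) * (∫ y, g y ∂ν)
        + if a = b then ∫ y, f y * g y ∂ν - (∫ y, f y ∂ν) * ∫ y, g y ∂ν else 0 := by
  split_ifs with hab
  · subst hab
    rw [integral_comp_eval_pi (f := fun y => f y * g y) (hf.mul hg)]
    ring
  · rw [(indepFun_comp_eval_pi hf hg hab).integral_fun_mul_eq_mul_integral
      (hf.comp (measurable_pi_apply a)).aestronglyMeasurable
      (hg.comp (measurable_pi_apply b)).aestronglyMeasurable,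
      integral_comp_eval_pi hf, integral_comp_eval_pi hg, add_zero]

theorem integrable_sampleAvg (hfi : Integrable f ν) (A : Finset (Fin n)) :
    Integrable (sampleAvg f A) (Measure.pi fun _ => ν) :=
  (integrable_finsetSum _ fun a _ => integrable_comp_eval_pi hfi a).div_const _

theorem integral_sampleAvg (hf : Measurable f) (hfi : Integrable f ν) {A : Finset (Fin n)}
    (hA : A.Nonempty) : ∫ x, sampleAvg f A x ∂(Measure.pi fun _ => ν) = ∫ y, f y ∂ν := by
  have hc : (A.card : ℝ) ≠ 0 := by exact_mod_cast hA.card_ne_zero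
  unfold sampleAvg
  rw [integral_div, integral_finsetSum _ fun a _ => integrable_comp_eval_pi hfi a]
  simp_rw [integral_comp_eval_pi hf]
  rw [Finset.sum_const, nsmul_eq_mul]
  field_simp

theorem integrable_sampleAvg_mul (hf : Measurable f) (hg : Measurable g) (hfi : Integrable f ν)
    (hgi : Integrable g ν) (hfg : Integrable (fun y => f y * g y) ν) (A : Finset (Fin n)) :
    Integrable (fun x => sampleAvg f A x * sampleAvg g A x) (Measure.pi fun _ => ν) := by
  simp_rw [sampleAvg_mul_sampleAvg]
  exact (integrable_finsetSum _ fun a _ => integrable_finsetSum _ fun b _ =>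
    integrable_eval_mul_eval_pi hf hg hfi hgi hfg a b).div_const _

theorem integral_sampleAvg_mul (hf : Measurable f) (hg : Measurable g) (hfi : Integrable f ν)
    (hgi : Integrable g ν) (hfg : Integrable (fun y => f y * g y) ν) {A : Finset (Fin n)}
    (hA : A.Nonempty) :
    ∫ x, sampleAvg f A x * sampleAvg g A x ∂(Measure.pi fun _ => ν)
      = (∫ y, f y ∂ν) * (∫ y, g y ∂ν)
        + (∫ y, f y * g y ∂ν - (∫ y, f y ∂ν) * ∫ y, g y ∂ν) / A.card := by
  have hc : (A.card : ℝ) ≠ 0 := by exact_mod_cast hA.card_ne_zero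
  have hi (a b : Fin n) := integrable_eval_mul_eval_pi hf hg hfi hgi hfg a b
  simp_rw [sampleAvg_mul_sampleAvg]
  rw [integral_div, integral_finsetSum _ fun a _ => integrable_finsetSum _ fun b _ => hi a b]
  simp_rw [integral_finsetSum _ fun b _ => hi _ b, integral_eval_mul_eval_pi hf hg,
    Finset.sum_add_distrib, Finset.sum_ite_eq]
  rw [Finset.sum_congr rfl fun a ha => if_pos ha]
  simp only [Finset.sum_const, nsmul_eq_mul]
  field_simp

theorem indepFun_sampleAvg {g' f' : E → ℝ} (hf : Measurable f) (hg : Measurable g)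
    (hf' : Measurable f') (hg' : Measurable g') {A B : Finset (Fin n)} (hAB : Disjoint A B) :
    IndepFun (fun x => (sampleAvg f A x, sampleAvg g A x))
      (fun x => (sampleAvg f' B x, sampleAvg g' B x)) (Measure.pi fun _ => ν) := by
  have h := (iIndepFun_pi (μ := fun _ : Fin n => ν) (X := fun _ y => y)
    fun _ => aemeasurable_id).indepFun_finset A B hAB fun i => measurable_pi_apply i
  have hm (f g : E → ℝ) (hf : Measurable f) (hg : Measurable g) (A : Finset (Fin n)) :
      Measurable fun y : A → E => ((∑ a, f (y a)) / (A.card : ℝ), (∑ a, g (y a)) / (A.card : ℝ)) := by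
    fun_prop
  have := h.comp (hm f g hf hg A) (hm f' g' hf' hg' B)
  have hs (f : E → ℝ) (A : Finset (Fin n)) (x : Fin n → E) :
      ∑ a : A, f (x a) = ∑ a ∈ A, f (x a) := Finset.sum_coe_sort A fun a => f (x a)
  simpa only [Function.comp_def, hs, sampleAvg] using this

section Moments

variable [Fintype κ] {f : κ → E → ℝ} {A B : Finset (Fin n)}

theorem measurable_splitStat (hf : ∀ q, Measurable (f q)) (A B : Finset (Fin n)) :
    Measurable (splitStat f A B) :=
  Finset.measurable_sum _ fun q _ =>
    (measurable_sampleAvg (hf q) A).mul (measurable_sampleAvg (hf q) B)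

theorem integral_splitStat (hf : ∀ q, Measurable (f q)) (hfi : ∀ q, Integrable (f q) ν)
    (hA : A.Nonempty) (hB : B.Nonempty) (hAB : Disjoint A B) :
    ∫ x, splitStat f A B x ∂(Measure.pi fun _ => ν) = ∑ q, (∫ y, f q y ∂ν) ^ 2 := by
  have hind (q : κ) : IndepFun (sampleAvg (f q) A) (sampleAvg (f q) B) (Measure.pi fun _ => ν) :=
    (indepFun_sampleAvg (hf q) (hf q) (hf q) (hf q) hAB).comp measurable_fst measurable_fst
  have hint (q : κ) : Integrable (fun x => sampleAvg (f q) A x * sampleAvg (f q) B x)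
      (Measure.pi fun _ => ν) :=
    (hind q).integrable_mul (integrable_sampleAvg (hfi q) A) (integrable_sampleAvg (hfi q) B)
  unfold splitStat
  rw [integral_finsetSum _ fun q _ => hint q]
  refine Finset.sum_congr rfl fun q _ => ?_
  rw [(hind q).integral_fun_mul_eq_mul_integral (measurable_sampleAvg (hf q) A).aestronglyMeasurable
    (measurable_sampleAvg (hf q) B).aestronglyMeasurable, integral_sampleAvg (hf q) (hfi q) hA,
    integral_sampleAvg (hf q) (hfi q) hB, sq]

theorem integrable_splitStat_sq (hf : ∀ q, Measurable (f q)) (hfi : ∀ q, Integrable (f q) ν)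
    (hff : ∀ q r, Integrable (fun y => f q y * f r y) ν)
    (hAB : Disjoint A B) :
    Integrable (fun x => splitStat f A B x ^ 2) (Measure.pi fun _ => ν) := by
  simp_rw [splitStat_sq]
  refine integrable_finsetSum _ fun q _ => integrable_finsetSum _ fun r _ => ?_
  exact ((indepFun_sampleAvg (hf q) (hf r) (hf q) (hf r) hAB).comp measurable_mul
    measurable_mul).integrable_mul
    (integrable_sampleAvg_mul (hf q) (hf r) (hfi q) (hfi r) (hff q r) A)
    (integrable_sampleAvg_mul (hf q) (hf r) (hfi q) (hfi r) (hff q r) B)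

theorem memLp_splitStat (hf : ∀ q, Measurable (f q)) (hfi : ∀ q, Integrable (f q) ν)
    (hff : ∀ q r, Integrable (fun y => f q y * f r y) ν)
    (hAB : Disjoint A B) :
    MemLp (splitStat f A B) 2 (Measure.pi fun _ => ν) :=
  (memLp_two_iff_integrable_sq (measurable_splitStat hf A B).aestronglyMeasurable).2
    (integrable_splitStat_sq hf hfi hff hAB)

/-- With means `μ`, covariances `C` and `m` observations per half, independence of the halves gives
`E[splitStat²] = Σ (μ_q μ_r + C_{qr}/m)²`; the leading term is the squared mean. -/
theorem variance_splitStat (hf : ∀ q, Measurable (f q)) (hfi : ∀ q, Integrable (f q) ν)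
    (hff : ∀ q r, Integrable (fun y => f q y * f r y) ν)
    (hA : A.Nonempty) (hAB : Disjoint A B) (hcard : A.card = B.card) :
    Var[splitStat f A B; Measure.pi fun _ => ν]
      = 2 / A.card * ∑ q, ∑ r, (∫ y, f q y ∂ν) * (∫ y, f r y ∂ν)
          * (∫ y, f q y * f r y ∂ν - (∫ y, f q y ∂ν) * ∫ y, f r y ∂ν)
        + 1 / (A.card : ℝ) ^ 2 * ∑ q, ∑ r,
          (∫ y, f q y * f r y ∂ν - (∫ y, f q y ∂ν) * ∫ y, f r y ∂ν) ^ 2 := by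
  have hB : B.Nonempty := by rw [← Finset.card_pos, ← hcard]; exact hA.card_pos
  have hind (q r : κ) : IndepFun (fun x => sampleAvg (f q) A x * sampleAvg (f r) A x)
      (fun x => sampleAvg (f q) B x * sampleAvg (f r) B x) (Measure.pi fun _ => ν) :=
    (indepFun_sampleAvg (hf q) (hf r) (hf q) (hf r) hAB).comp measurable_mul measurable_mul
  have hi (q r : κ) (A : Finset (Fin n)) :=
    integrable_sampleAvg_mul (hf q) (hf r) (hfi q) (hfi r) (hff q r) A
  rw [variance_eq_sub (memLp_splitStat hf hfi hff hAB)]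
  simp only [Pi.pow_apply]
  rw [integral_splitStat hf hfi hA hB hAB]
  simp_rw [splitStat_sq]
  have hint (q r : κ) : Integrable (fun x => sampleAvg (f q) A x * sampleAvg (f r) A x
      * (sampleAvg (f q) B x * sampleAvg (f r) B x)) (Measure.pi fun _ => ν) :=
    (hind q r).integrable_mul (hi q r A) (hi q r B)
  rw [integral_finsetSum _ fun q _ => integrable_finsetSum _ fun r _ => hint q r]
  simp_rw [integral_finsetSum _ fun r _ => hint _ r]
  have hterm (q r : κ) : ∫ x, sampleAvg (f q) A x * sampleAvg (f r) A x
        * (sampleAvg (f q) B x * sampleAvg (f r) B x) ∂(Measure.pi fun _ => ν)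
      = (∫ y, f q y ∂ν) ^ 2 * (∫ y, f r y ∂ν) ^ 2
        + 2 / A.card * ((∫ y, f q y ∂ν) * (∫ y, f r y ∂ν)
          * (∫ y, f q y * f r y ∂ν - (∫ y, f q y ∂ν) * ∫ y, f r y ∂ν))
        + 1 / (A.card : ℝ) ^ 2
          * (∫ y, f q y * f r y ∂ν - (∫ y, f q y ∂ν) * ∫ y, f r y ∂ν) ^ 2 := by
    rw [(hind q r).integral_fun_mul_eq_mul_integral (hi q r A).aestronglyMeasurable
      (hi q r B).aestronglyMeasurable,
      integral_sampleAvg_mul (hf q) (hf r) (hfi q) (hfi r) (hff q r) hA,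
      integral_sampleAvg_mul (hf q) (hf r) (hfi q) (hfi r) (hff q r) hB, ← hcard]
    ring
  simp_rw [hterm, Finset.sum_add_distrib, ← Finset.mul_sum, ← Finset.sum_mul]
  ring

end Moments

end SplitSample

/-! ### Comparing `Σ⁻¹ - 1` with `Σ - 1` -/

section CorrelationMatrices

open Matrix

variable {ι : Type*}

theorem posDef_of_posSemidef_sub_smul_one [DecidableEq ι] {S : Matrix ι ι ℝ} {l : ℝ} (hl : 0 < l)
    (hS : (S - l • (1 : Matrix ι ι ℝ)).PosSemidef) : S.PosDef := by
  have : S = l • (1 : Matrix ι ι ℝ) + (S - l • (1 : Matrix ι ι ℝ)) := by abel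
  rw [this]
  exact (PosDef.one.smul hl).add_posSemidef hS

variable [Fintype ι]

theorem abs_apply_le_one_of_posSemidef {S : Matrix ι ι ℝ} (hS : S.PosSemidef)
    (h1 : ∀ i, S i i = 1) (i j : ι) : |S i j| ≤ 1 := by
  classical
  have hsymm : S j i = S i j := by simpa using hS.isHermitian.apply i j
  have key (c : ℝ) : 0 ≤ 1 + c * (2 * S i j) + c ^ 2 := by
    have := hS.dotProduct_mulVec_nonneg (Pi.single i 1 + c • Pi.single j 1)
    simp only [star_trivial, mulVec_add, mulVec_smul, add_dotProduct, dotProduct_add,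
      smul_dotProduct, dotProduct_smul, single_dotProduct, mulVec_single, smul_eq_mul, one_mul,
      MulOpposite.op_one, one_smul, col_apply, h1, hsymm] at this
    linarith
  rw [abs_le]
  constructor
  · linarith [key 1]
  · linarith [key (-1)]

/-- Expand `‖Sv - lv‖² ≥ 0` and use `⟨v, Sv⟩ ≥ l‖v‖²`; no diagonalisation is needed. -/
theorem sq_mul_dotProduct_le_of_posSemidef_sub [DecidableEq ι] {S : Matrix ι ι ℝ} {l : ℝ}
    (hl : 0 < l) (hS : (S - l • (1 : Matrix ι ι ℝ)).PosSemidef) (v : ι → ℝ) :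
    l ^ 2 * (v ⬝ᵥ v) ≤ (S *ᵥ v) ⬝ᵥ (S *ᵥ v) := by
  have h1 : l * (v ⬝ᵥ v) ≤ v ⬝ᵥ S *ᵥ v := by
    have := hS.dotProduct_mulVec_nonneg v
    simp only [star_trivial, sub_mulVec, smul_mulVec, one_mulVec, dotProduct_sub, dotProduct_smul,
      smul_eq_mul] at this
    linarith
  have h2 : 0 ≤ (S *ᵥ v - l • v) ⬝ᵥ (S *ᵥ v - l • v) := by
    simpa using dotProduct_star_self_nonneg (S *ᵥ v - l • v)
  simp only [sub_dotProduct, dotProduct_sub, smul_dotProduct, dotProduct_smul, smul_eq_mul] at h2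
  rw [dotProduct_comm (S *ᵥ v) v] at h2
  nlinarith

section Frobenius

attribute [local instance] Matrix.frobeniusNormedAddCommGroup

/-- Apply the vector bound to each column of `S⁻¹ - 1`, since `S(S⁻¹ - 1) = 1 - S`. -/
theorem frobenius_norm_inv_sub_one_le [DecidableEq ι] {S : Matrix ι ι ℝ} {l : ℝ} (hl : 0 < l)
    (hS : (S - l • (1 : Matrix ι ι ℝ)).PosSemidef) :
    l ^ 2 * ‖S⁻¹ - 1‖ ^ 2 ≤ ∑ i, ∑ j, (S - 1) i j ^ 2 := by
  have hu : IsUnit S.det :=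
    isUnit_iff_ne_zero.2 (posDef_of_posSemidef_sub_smul_one hl hS).det_pos.ne'
  have hmul : S * (S⁻¹ - 1) = 1 - S := by rw [mul_sub, mul_nonsing_inv _ hu, mul_one]
  rw [Matrix.frobenius_norm_sq, Finset.sum_comm, Finset.mul_sum,
    Finset.sum_comm (f := fun i j => (S - 1) i j ^ 2)]
  refine Finset.sum_le_sum fun j _ => ?_
  have := sq_mul_dotProduct_le_of_posSemidef_sub hl hS fun i => (S⁻¹ - 1) i j
  have hcol : (S *ᵥ fun i => (S⁻¹ - 1) i j) = fun i => (1 - S) i j := by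
    rw [← hmul]
    rfl
  rw [hcol] at this
  simp only [dotProduct, ← sq] at this
  refine this.trans (le_of_eq (Finset.sum_congr rfl fun i _ => ?_))
  simp only [Matrix.sub_apply]
  ring

end Frobenius

end CorrelationMatrices

/-! ### Row sums over the ellipsoid class -/

namespace InverseCovarianceTest

open Matrix

/-- The sum of `|z| ^ (-β)` over the nonzero integers. -/
noncomputable def intZeta (β : ℝ) : ℝ := ∑' z : ℤ, |(z : ℝ)| ^ (-β)

theorem intZeta_nonneg (β : ℝ) : 0 ≤ intZeta β := tsum_nonneg fun _ => by positivity

theorem sum_abs_sub_rpow_le {β : ℝ} (hβ : 1 < β) {p : ℕ} (i : Fin p) :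
    ∑ j : Fin p, |(i : ℝ) - (j : ℝ)| ^ (-β) ≤ intZeta β := by
  have hinj : Function.Injective fun j : Fin p => ((i : ℕ) : ℤ) - (j : ℕ) := fun j j' h => by
    apply Fin.ext
    simp only at h
    omega
  have := (Real.summable_abs_int_rpow hβ).sum_le_tsum
    (Finset.univ.map ⟨_, hinj⟩) fun _ _ => by positivity
  rw [Finset.sum_map] at this
  simpa [intZeta] using this

variable {α L lam : ℝ} {p : ℕ} {S : Matrix (Fin p) (Fin p) ℝ}

theorem classF_symm (hS : S ∈ classF α L p) (i j : Fin p) : S i j = S j i := by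
  simpa using hS.1.isHermitian.apply j i

theorem sum_upper_le (hS : S ∈ classF α L p) (hp : 0 < p) :
    ∑ i : Fin p, ∑ j : Fin p, (if i < j then S i j ^ 2 * |(i : ℝ) - (j : ℝ)| ^ (2 * α) else 0)
      ≤ p * L := by
  have h := hS.2.2
  have hp' : (0 : ℝ) < p := by exact_mod_cast hp
  rwa [one_div, inv_mul_le_iff₀ hp'] at h

theorem sum_symm_eq_two_mul_sum_upper {f : Fin p → Fin p → ℝ} (hf : ∀ i j, f i j = f j i)
    (h0 : ∀ i, f i i = 0) :
    ∑ i, ∑ j, f i j = 2 * ∑ i, ∑ j, (if i < j then f i j else 0) := by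
  have h (i j : Fin p) : f i j = (if i < j then f i j else 0) + if j < i then f j i else 0 := by
    rcases lt_trichotomy i j with h | h | h
    · simp [h, h.not_gt]
    · subst h; simp [h0]
    · simp [h, h.not_gt, hf i j]
  rw [Finset.sum_congr rfl fun i _ => Finset.sum_congr rfl fun j _ => h i j]
  simp_rw [Finset.sum_add_distrib]
  rw [Finset.sum_comm (f := fun i j => if j < i then f j i else 0)]
  ring

theorem sum_weighted_le (hα : 0 < α) (hS : S ∈ classF α L p) (hp : 0 < p) :
    ∑ i : Fin p, ∑ j : Fin p, S i j ^ 2 * |(i : ℝ) - (j : ℝ)| ^ (2 * α) ≤ 2 * (p * L) := by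
  rw [sum_symm_eq_two_mul_sum_upper]
  · gcongr
    exact sum_upper_le hS hp
  · intro i j
    rw [classF_symm hS i j, abs_sub_comm]
  · intro i
    simp [Real.zero_rpow (by positivity : 2 * α ≠ 0)]

theorem one_le_abs_sub {i j : Fin p} (h : i ≠ j) : 1 ≤ |(i : ℝ) - (j : ℝ)| := by
  have : (1 : ℤ) ≤ |((i : ℕ) : ℤ) - (j : ℕ)| := Int.one_le_abs (by
    intro h0
    exact h (Fin.ext (by omega)))
  exact_mod_cast this

/-- With `P = p^{1/4}` and `d = |i - j|`, entries below `P d^{-2α/3}` are summable over the row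
because `2α/3 > 1`. An entry `a` above it satisfies `a ≤ a² d^{2α}/P³`, thanks to `a ≤ 1`, and the
weighted row energy is at most `2LP⁴`. Both parts are of order `P`; plain Cauchy–Schwarz against the
weights would only give `√p`. -/
theorem sum_abs_row_le (hα : 3 / 2 < α) (hS : S ∈ classF α L p) (hp : 0 < p)
    (i : Fin p) :
    ∑ j, |S i j| ≤ (1 + 2 * L + intZeta (2 * α / 3)) * (p : ℝ) ^ (1 / 4 : ℝ) := by
  have hp' : (1 : ℝ) ≤ p := by exact_mod_cast hp
  set P := (p : ℝ) ^ (1 / 4 : ℝ) with hP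
  have hP1 : 1 ≤ P := Real.one_le_rpow hp' (by norm_num)
  have hP0 : 0 < P := by linarith
  have hP4 : P ^ 4 = p := by
    rw [hP, ← Real.rpow_natCast, ← Real.rpow_mul (by positivity)]; norm_num
  have hentry (j : Fin p) : |S i j| ≤ (if i = j then 1 else 0)
      + S i j ^ 2 * |(i : ℝ) - (j : ℝ)| ^ (2 * α) / P ^ 3
      + P * |(i : ℝ) - (j : ℝ)| ^ (-(2 * α / 3)) := by
    have hle := abs_apply_le_one_of_posSemidef hS.1 hS.2.1 i j
    split_ifs with hij
    · have : 0 ≤ S i j ^ 2 * |(i : ℝ) - (j : ℝ)| ^ (2 * α) / P ^ 3 := by positivity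
      have : 0 ≤ P * |(i : ℝ) - (j : ℝ)| ^ (-(2 * α / 3)) := by positivity
      linarith
    · have hd : 0 < |(i : ℝ) - (j : ℝ)| := by linarith [one_le_abs_sub hij]
      set u := |(i : ℝ) - (j : ℝ)| ^ (2 * α / 3) with hu
      have hu0 : 0 < u := by positivity
      have hw : |(i : ℝ) - (j : ℝ)| ^ (2 * α) = u ^ 3 := by
        rw [hu, ← Real.rpow_natCast, ← Real.rpow_mul hd.le]; congr 1; push_cast; ring
      rw [Real.rpow_neg hd.le, ← hu, hw, ← sq_abs, zero_add, ← div_eq_mul_inv]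
      set a := |S i j| with ha
      have ha0 : 0 ≤ a := abs_nonneg _
      rcases le_total a (P / u) with h | h
      · have : 0 ≤ a ^ 2 * u ^ 3 / P ^ 3 := by positivity
        linarith
      · have h1 : P ≤ a * u := by rwa [div_le_iff₀ hu0] at h
        have h2 : a ≤ a ^ 2 * u ^ 3 / P ^ 3 := by
          rw [le_div_iff₀ (by positivity)]
          have h3 : P ^ 3 ≤ (a * u) ^ 3 := by gcongr
          calc a * P ^ 3 ≤ a * (a * u) ^ 3 := by gcongr
            _ = a ^ 2 * (a * a) * u ^ 3 := by ring
            _ ≤ a ^ 2 * (1 * 1) * u ^ 3 := by gcongr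
            _ = _ := by ring
        have : 0 ≤ P / u := by positivity
        linarith
  have hrow : ∑ j : Fin p, S i j ^ 2 * |(i : ℝ) - (j : ℝ)| ^ (2 * α) ≤ 2 * (p * L) := by
    refine le_trans ?_ (sum_weighted_le (by linarith) hS hp)
    exact Finset.single_le_sum
      (f := fun i : Fin p => ∑ j : Fin p, S i j ^ 2 * |(i : ℝ) - (j : ℝ)| ^ (2 * α))
      (fun i _ => Finset.sum_nonneg fun j _ => by positivity) (Finset.mem_univ i)
  calc ∑ j, |S i j| ≤ ∑ j : Fin p, ((if i = j then 1 else 0)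
      + S i j ^ 2 * |(i : ℝ) - (j : ℝ)| ^ (2 * α) / P ^ 3
      + P * |(i : ℝ) - (j : ℝ)| ^ (-(2 * α / 3))) := Finset.sum_le_sum fun j _ => hentry j
    _ = 1 + (∑ j : Fin p, S i j ^ 2 * |(i : ℝ) - (j : ℝ)| ^ (2 * α)) / P ^ 3
        + P * ∑ j : Fin p, |(i : ℝ) - (j : ℝ)| ^ (-(2 * α / 3)) := by
        rw [Finset.sum_add_distrib, Finset.sum_add_distrib, Finset.sum_ite_eq, Finset.sum_div,
          Finset.mul_sum]
        simp
    _ ≤ P + 2 * (p * L) / P ^ 3 + P * intZeta (2 * α / 3) := by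
        gcongr
        exact sum_abs_sub_rpow_le (by linarith) i
    _ = _ := by rw [← hP4]; field_simp

/-- Cauchy–Schwarz with weights `d^{2α}` and `d^{-2α}`, together with `|S i j| ≤ 1`, makes the
squared off-diagonal row energy linear in the weighted one, so that summing over rows costs only
`O(p)`. -/
theorem sum_sq_row_le (hα : 1 / 2 < α) (hS : S ∈ classF α L p) (i : Fin p) :
    (∑ j, S i j ^ 2) ^ 2 ≤ 2 + 2 * intZeta (2 * α)
      * ∑ j : Fin p, S i j ^ 2 * |(i : ℝ) - (j : ℝ)| ^ (2 * α) := by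
  have hle (j : Fin p) : S i j ^ 2 ≤ 1 := by
    rw [← sq_abs]
    exact pow_le_one₀ (abs_nonneg _) (abs_apply_le_one_of_posSemidef hS.1 hS.2.1 i j)
  set r : Fin p → ℝ := fun j => if i = j then 0 else S i j ^ 2 with hr
  have hsplit : ∑ j, S i j ^ 2 = 1 + ∑ j, r j := by
    have (j : Fin p) : S i j ^ 2 = (if i = j then 1 else 0) + r j := by
      rw [hr]
      split_ifs with h
      · subst h; simp [hS.2.1]
      · simp [h]
    rw [Finset.sum_congr rfl fun j _ => this j, Finset.sum_add_distrib]
    simp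
  have hcs : (∑ j, r j) ^ 2 ≤ (∑ j : Fin p, S i j ^ 2 * |(i : ℝ) - (j : ℝ)| ^ (2 * α))
      * ∑ j : Fin p, S i j ^ 2 * |(i : ℝ) - (j : ℝ)| ^ (-(2 * α)) := by
    refine Finset.sum_sq_le_sum_mul_sum_of_sq_le_mul _ (fun j _ => by positivity)
      (fun j _ => by positivity) fun j _ => le_of_eq ?_
    simp only [hr]
    split_ifs with h
    · subst h
      simp [Real.zero_rpow (by linarith : 2 * α ≠ 0)]
    · have hd : 0 < |(i : ℝ) - (j : ℝ)| := by linarith [one_le_abs_sub h]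
      rw [Real.rpow_neg hd.le]
      field_simp
  have hz : ∑ j : Fin p, S i j ^ 2 * |(i : ℝ) - (j : ℝ)| ^ (-(2 * α)) ≤ intZeta (2 * α) := by
    refine le_trans (Finset.sum_le_sum fun j _ => ?_) (sum_abs_sub_rpow_le (by linarith) i)
    exact mul_le_of_le_one_left (by positivity) (hle j)
  have h0 : 0 ≤ ∑ j : Fin p, S i j ^ 2 * |(i : ℝ) - (j : ℝ)| ^ (2 * α) :=
    Finset.sum_nonneg fun j _ => by positivity
  have := hcs.trans (mul_le_mul_of_nonneg_left hz h0)
  rw [hsplit]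
  nlinarith [sq_nonneg (1 - ∑ j, r j)]

theorem sum_sum_sq_row_le (hα : 1 / 2 < α) (hS : S ∈ classF α L p) (hp : 0 < p) :
    ∑ i, (∑ j, S i j ^ 2) ^ 2 ≤ (2 + 4 * L * intZeta (2 * α)) * p := by
  refine (Finset.sum_le_sum fun i _ => sum_sq_row_le hα hS i).trans ?_
  rw [Finset.sum_add_distrib, ← Finset.mul_sum]
  have h1 := mul_le_mul_of_nonneg_left (sum_weighted_le (by linarith) hS hp)
    (mul_nonneg zero_le_two (intZeta_nonneg (2 * α)))
  simp only [Finset.sum_const, Finset.card_univ, Fintype.card_fin, nsmul_eq_mul]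
  linarith

theorem le_sum_upper_sq {ψ : ℝ} (hlam : 0 < lam) (hp : 0 < p)
    (hS : S ∈ altInverse α L lam p ψ) :
    p * (lam ^ 2 * ψ ^ 2) ≤ ∑ i : Fin p, ∑ j : Fin p, (if i < j then S i j ^ 2 else 0) := by
  obtain ⟨⟨hF, hspec⟩, hψ⟩ := hS
  have hp' : (0 : ℝ) < p := by exact_mod_cast hp
  rw [Matrix.forall_spectrum_le_iff_posSemidef_sub hF.1] at hspec
  have h1 := frobenius_norm_inv_sub_one_le hlam hspec
  rw [one_div, le_inv_mul_iff₀ (by positivity)] at hψ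
  have h2 : ∑ i, ∑ j, (S - 1) i j ^ 2
      = 2 * ∑ i : Fin p, ∑ j : Fin p, (if i < j then S i j ^ 2 else 0) := by
    rw [sum_symm_eq_two_mul_sum_upper]
    · congr 1
      refine Finset.sum_congr rfl fun i _ => Finset.sum_congr rfl fun j _ => ?_
      split_ifs with h
      · simp [Matrix.sub_apply, h.ne]
      · rfl
    · intro i j
      simp [Matrix.sub_apply, Matrix.one_apply, classF_symm hF i j, eq_comm]
    · intro i
      simp [hF.2.1]
  rw [h2] at h1
  have h3 := mul_le_mul_of_nonneg_left hψ (sq_nonneg lam)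
  linarith

end InverseCovarianceTest

/-! ### The band statistic: bias and variance -/

namespace InverseCovarianceTest

open Matrix

/-- The indicator of the pairs `(i, j)` with `i < j ≤ i + T`. -/
def band {p : ℕ} (T : ℕ) (q : Fin p × Fin p) : ℝ :=
  if q.1 < q.2 ∧ (q.2 : ℕ) ≤ q.1 + T then 1 else 0

variable {p T : ℕ}

theorem band_nonneg (q : Fin p × Fin p) : 0 ≤ band T q := by
  unfold band; split_ifs <;> norm_num

theorem band_le_one (q : Fin p × Fin p) : band T q ≤ 1 := by
  unfold band; split_ifs <;> norm_num

theorem band_sq (q : Fin p × Fin p) : band T q ^ 2 = band T q := by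
  unfold band; split_ifs <;> norm_num

theorem sum_band_right_le (i : Fin p) : ∑ j, band T (i, j) ≤ T := by
  simp only [band]
  rw [Finset.sum_boole]
  have : (Finset.univ.filter fun j : Fin p => i < j ∧ (j : ℕ) ≤ i + T).card
      ≤ (Finset.Ioc (i : ℕ) (i + T)).card :=
    Finset.card_le_card_of_injOn Fin.val (fun j hj => by
      simp only [Finset.coe_filter, Finset.mem_univ, true_and, Set.mem_ofPred_eq] at hj
      exact Finset.mem_coe.2 (Finset.mem_Ioc.2 ⟨hj.1, hj.2⟩)) Fin.val_injective.injOn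
  rw [Nat.card_Ioc, Nat.add_sub_cancel_left] at this
  exact_mod_cast this

theorem sum_band_left_le (j : Fin p) : ∑ i, band T (i, j) ≤ T := by
  simp only [band]
  rw [Finset.sum_boole]
  have : (Finset.univ.filter fun i : Fin p => i < j ∧ (j : ℕ) ≤ i + T).card
      ≤ (Finset.Ico ((j : ℕ) - T) j).card :=
    Finset.card_le_card_of_injOn Fin.val (fun i hi => by
      simp only [Finset.coe_filter, Finset.mem_univ, true_and, Set.mem_ofPred_eq] at hi
      refine Finset.mem_coe.2 (Finset.mem_Ico.2 ⟨?_, hi.1⟩)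
      omega) Fin.val_injective.injOn
  rw [Nat.card_Ico] at this
  have h2 : (Finset.univ.filter fun i : Fin p => i < j ∧ (j : ℕ) ≤ i + T).card ≤ T := by omega
  exact_mod_cast h2

/-- The products of coordinates at distance at most `T`. -/
def bandProduct (T : ℕ) (q : Fin p × Fin p) (x : EuclideanSpace ℝ (Fin p)) : ℝ :=
  band T q * (x q.1 * x q.2)

/-- The energy of the band of width `T` above the diagonal. -/
def bandEnergy (T : ℕ) (S : Matrix (Fin p) (Fin p) ℝ) : ℝ := ∑ q, (band T q * S q.1 q.2) ^ 2

/-- The covariance of the products of coordinates of a centred Gaussian vector. -/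
def productCov (S : Matrix (Fin p) (Fin p) ℝ) (q r : Fin p × Fin p) : ℝ :=
  S q.1 r.1 * S q.2 r.2 + S q.1 r.2 * S q.2 r.1

section Moments

variable {S : Matrix (Fin p) (Fin p) ℝ}

theorem measurable_bandProduct (q : Fin p × Fin p) : Measurable (bandProduct T q) := by
  unfold bandProduct; fun_prop

theorem integrable_bandProduct (q : Fin p × Fin p) :
    Integrable (bandProduct T q) (multivariateGaussian 0 S) :=
  (integrable_mul_multivariateGaussian _ _).const_mul _

theorem integral_bandProduct (hS : S.PosSemidef) (q : Fin p × Fin p) :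
    ∫ x, bandProduct T q x ∂multivariateGaussian 0 S = band T q * S q.1 q.2 := by
  unfold bandProduct
  rw [integral_const_mul, integral_mul_multivariateGaussian hS]

theorem bandProduct_mul (q r : Fin p × Fin p) (x : EuclideanSpace ℝ (Fin p)) :
    bandProduct T q x * bandProduct T r x
      = band T q * band T r * (x q.1 * x q.2 * x r.1 * x r.2) := by
  unfold bandProduct; ring

theorem integrable_bandProduct_mul (q r : Fin p × Fin p) :
    Integrable (fun x => bandProduct T q x * bandProduct T r x) (multivariateGaussian 0 S) := by
  simp_rw [bandProduct_mul]
  exact (integrable_mul_four_multivariateGaussian _ _ _ _).const_mul _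

theorem integral_bandProduct_mul (hS : S.PosSemidef) (q r : Fin p × Fin p) :
    ∫ x, bandProduct T q x * bandProduct T r x ∂multivariateGaussian 0 S
      - (∫ x, bandProduct T q x ∂multivariateGaussian 0 S)
        * ∫ x, bandProduct T r x ∂multivariateGaussian 0 S
      = band T q * band T r * productCov S q r := by
  simp_rw [bandProduct_mul]
  rw [integral_const_mul, integral_mul_four_multivariateGaussian hS, integral_bandProduct hS,
    integral_bandProduct hS, productCov]
  ring

end Moments

section CovarianceSums

variable {S : Matrix (Fin p) (Fin p) ℝ} {R : ℝ}

theorem abs_productCov_le (q r : Fin p × Fin p) :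
    |productCov S q r| ≤ |S q.1 r.1| * |S q.2 r.2| + |S q.1 r.2| * |S q.2 r.1| := by
  unfold productCov
  refine (abs_add_le _ _).trans ?_
  rw [abs_mul, abs_mul]

theorem productCov_comm (hS : Sᵀ = S) (q r : Fin p × Fin p) :
    productCov S q r = productCov S r q := by
  have h (i j : Fin p) : S i j = S j i := congrFun (congrFun hS.symm i) j
  unfold productCov
  rw [h q.1 r.1, h q.2 r.2, h q.1 r.2, h q.2 r.1]
  ring

theorem sum_abs_productCov_le (hR : ∀ i, ∑ j, |S i j| ≤ R) (q : Fin p × Fin p) :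
    ∑ r, |productCov S q r| ≤ 2 * R ^ 2 := by
  have h0 (i : Fin p) : 0 ≤ ∑ j, |S i j| := Finset.sum_nonneg fun j _ => abs_nonneg _
  have hR0 : 0 ≤ R := (h0 q.1).trans (hR q.1)
  refine (Finset.sum_le_sum fun r _ => abs_productCov_le q r).trans ?_
  have hsplit : ∑ r : Fin p × Fin p, (|S q.1 r.1| * |S q.2 r.2| + |S q.1 r.2| * |S q.2 r.1|)
      = 2 * ((∑ j, |S q.1 j|) * ∑ j, |S q.2 j|) := by
    rw [Finset.sum_add_distrib, Fintype.sum_prod_type, Fintype.sum_prod_type, Finset.sum_mul_sum]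
    rw [Finset.sum_comm (f := fun x y => |S q.1 y| * |S q.2 x|)]
    ring
  rw [hsplit, sq]
  have := mul_le_mul (hR q.1) (hR q.2) (h0 q.2) hR0
  linarith

/-- Schur's test: the quadratic form of a symmetric matrix is bounded by its largest absolute row
sum. -/
theorem sum_mul_productCov_le (hS : Sᵀ = S) (hR : ∀ i, ∑ j, |S i j| ≤ R)
    (m : Fin p × Fin p → ℝ) :
    ∑ q, ∑ r, m q * m r * productCov S q r ≤ 2 * R ^ 2 * ∑ q, m q ^ 2 := by
  have h1 (q r : Fin p × Fin p) : m q * m r * productCov S q r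
      ≤ m q ^ 2 * |productCov S q r| / 2 + m r ^ 2 * |productCov S r q| / 2 := by
    rw [← productCov_comm hS q r]
    have h2 : |m q * m r| * |productCov S q r| ≤ (m q ^ 2 + m r ^ 2) / 2 * |productCov S q r| := by
      gcongr
      rw [abs_mul, ← sq_abs (m q), ← sq_abs (m r)]
      nlinarith [sq_nonneg (|m q| - |m r|)]
    have h3 := le_abs_self (m q * m r * productCov S q r)
    rw [abs_mul] at h3
    linarith
  calc _ ≤ ∑ q, ∑ r, (m q ^ 2 * |productCov S q r| / 2 + m r ^ 2 * |productCov S r q| / 2) :=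
        Finset.sum_le_sum fun q _ => Finset.sum_le_sum fun r _ => h1 q r
    _ = ∑ q, m q ^ 2 * ∑ r, |productCov S q r| := by
        simp_rw [Finset.sum_add_distrib]
        rw [Finset.sum_comm (f := fun q r => m r ^ 2 * |productCov S r q| / 2),
          ← Finset.sum_add_distrib]
        refine Finset.sum_congr rfl fun q _ => ?_
        rw [← Finset.sum_div, ← Finset.mul_sum]
        ring
    _ ≤ ∑ q, m q ^ 2 * (2 * R ^ 2) :=
        Finset.sum_le_sum fun q _ =>
          mul_le_mul_of_nonneg_left (sum_abs_productCov_le hR q) (sq_nonneg _)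
    _ = _ := by rw [← Finset.sum_mul]; ring

theorem sum_productCov_sq_le (q : Fin p × Fin p) :
    ∑ r, productCov S q r ^ 2
      ≤ 2 * (∑ j, S q.1 j ^ 2) ^ 2 + 2 * (∑ j, S q.2 j ^ 2) ^ 2 := by
  calc ∑ r, productCov S q r ^ 2
      ≤ ∑ r : Fin p × Fin p, 2 * (S q.1 r.1 ^ 2 * S q.2 r.2 ^ 2 + S q.1 r.2 ^ 2 * S q.2 r.1 ^ 2) := by
        refine Finset.sum_le_sum fun r _ => ?_
        unfold productCov
        nlinarith [sq_nonneg (S q.1 r.1 * S q.2 r.2 - S q.1 r.2 * S q.2 r.1)]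
    _ = 4 * ((∑ j, S q.1 j ^ 2) * ∑ j, S q.2 j ^ 2) := by
        rw [← Finset.mul_sum, Finset.sum_add_distrib, Fintype.sum_prod_type, Fintype.sum_prod_type,
          Finset.sum_mul_sum, Finset.sum_comm (f := fun x y => S q.1 y ^ 2 * S q.2 x ^ 2)]
        ring
    _ ≤ _ := by nlinarith [sq_nonneg ((∑ j, S q.1 j ^ 2) - ∑ j, S q.2 j ^ 2)]

/-- Each index is the left end of at most `T` band pairs and the right end of at most `T`, whence
the factor `T` in place of `p`. -/
theorem sum_band_productCov_sq_le :
    ∑ q, ∑ r, (band T q * band T r * productCov S q r) ^ 2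
      ≤ 4 * T * ∑ i, (∑ j, S i j ^ 2) ^ 2 := by
  set ρ : Fin p → ℝ := fun i => (∑ j, S i j ^ 2) ^ 2 with hρ
  have hρ0 (i : Fin p) : 0 ≤ ρ i := sq_nonneg _
  calc _ ≤ ∑ q, band T q * ∑ r, productCov S q r ^ 2 := by
        refine Finset.sum_le_sum fun q _ => ?_
        rw [Finset.mul_sum]
        refine Finset.sum_le_sum fun r _ => ?_
        rw [mul_pow, mul_pow, band_sq, band_sq, mul_assoc]
        refine mul_le_mul_of_nonneg_left ?_ (band_nonneg q)
        exact mul_le_of_le_one_left (sq_nonneg _) (band_le_one r)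
    _ ≤ ∑ q : Fin p × Fin p, band T q * (2 * ρ q.1 + 2 * ρ q.2) :=
        Finset.sum_le_sum fun q _ =>
          mul_le_mul_of_nonneg_left (sum_productCov_sq_le q) (band_nonneg q)
    _ = 2 * ∑ i, (∑ j, band T (i, j)) * ρ i + 2 * ∑ j, (∑ i, band T (i, j)) * ρ j := by
        simp_rw [mul_add]
        rw [Finset.sum_add_distrib, Fintype.sum_prod_type, Fintype.sum_prod_type_right]
        simp_rw [Finset.mul_sum, Finset.sum_mul, Finset.mul_sum]
        congr 1 <;>
        exact Finset.sum_congr rfl fun i _ => Finset.sum_congr rfl fun j _ => by ring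
    _ ≤ 2 * ∑ i, T * ρ i + 2 * ∑ j, T * ρ j := by
        have h1 : ∑ i, (∑ j, band T (i, j)) * ρ i ≤ ∑ i, T * ρ i :=
          Finset.sum_le_sum fun i _ => mul_le_mul_of_nonneg_right (sum_band_right_le i) (hρ0 i)
        have h2 : ∑ j, (∑ i, band T (i, j)) * ρ j ≤ ∑ j, T * ρ j :=
          Finset.sum_le_sum fun j _ => mul_le_mul_of_nonneg_right (sum_band_left_le j) (hρ0 j)
        linarith
    _ = _ := by rw [← Finset.mul_sum]; ring

/-- Outside the band `|i - j| ≥ T`, so the ellipsoid weight gains a factor `T^{2α}`: this is the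
bias of truncation. -/
theorem sum_upper_sq_le_bandEnergy_add {α L : ℝ} (hα : 0 < α) (hT : T ≠ 0)
    (hS : S ∈ classF α L p) (hp : 0 < p) :
    ∑ i : Fin p, ∑ j : Fin p, (if i < j then S i j ^ 2 else 0)
      ≤ bandEnergy T S + p * L * (T : ℝ) ^ (-(2 * α)) := by
  have hT0 : (0 : ℝ) < T := by exact_mod_cast Nat.pos_of_ne_zero hT
  have hentry (i j : Fin p) : (if i < j then S i j ^ 2 else 0) ≤ (band T (i, j) * S i j) ^ 2
      + (if i < j then S i j ^ 2 * |(i : ℝ) - (j : ℝ)| ^ (2 * α) else 0)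
        * (T : ℝ) ^ (-(2 * α)) := by
    by_cases hij : i < j
    · by_cases hb : (j : ℕ) ≤ i + T
      · have : 0 ≤ S i j ^ 2 * |(i : ℝ) - (j : ℝ)| ^ (2 * α) * (T : ℝ) ^ (-(2 * α)) := by positivity
        simpa [band, hij, hb] using this
      · have hd : (T : ℝ) ≤ |(i : ℝ) - (j : ℝ)| := by
          have h1 : ((i : ℕ) : ℝ) + T ≤ (j : ℕ) := by exact_mod_cast (not_le.1 hb).le
          rw [abs_sub_comm]
          exact le_trans (by linarith) (le_abs_self _)
        have h2 : (T : ℝ) ^ (2 * α) ≤ |(i : ℝ) - (j : ℝ)| ^ (2 * α) :=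
          Real.rpow_le_rpow hT0.le hd (by linarith)
        have h3 : S i j ^ 2 ≤ S i j ^ 2 * |(i : ℝ) - (j : ℝ)| ^ (2 * α) * (T : ℝ) ^ (-(2 * α)) := by
          rw [Real.rpow_neg hT0.le, ← div_eq_mul_inv, le_div_iff₀ (by positivity)]
          gcongr
        simpa [band, hij, hb] using h3
    · simpa [hij] using sq_nonneg (band T (i, j) * S i j)
  calc _ ≤ ∑ i : Fin p, ∑ j : Fin p, ((band T (i, j) * S i j) ^ 2
      + (if i < j then S i j ^ 2 * |(i : ℝ) - (j : ℝ)| ^ (2 * α) else 0)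
        * (T : ℝ) ^ (-(2 * α))) :=
        Finset.sum_le_sum fun i _ => Finset.sum_le_sum fun j _ => hentry i j
    _ = bandEnergy T S + (∑ i : Fin p, ∑ j : Fin p,
        (if i < j then S i j ^ 2 * |(i : ℝ) - (j : ℝ)| ^ (2 * α) else 0))
        * (T : ℝ) ^ (-(2 * α)) := by
        simp_rw [Finset.sum_add_distrib, ← Finset.sum_mul]
        rw [bandEnergy, Fintype.sum_prod_type]
    _ ≤ _ := by
        gcongr
        exact sum_upper_le hS hp

end CovarianceSums

section BandStatistic

variable {n : ℕ} {A B : Finset (Fin n)} {α L : ℝ} {S : Matrix (Fin p) (Fin p) ℝ}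

theorem integral_bandStat (hS : S.PosSemidef) (hA : A.Nonempty) (hB : B.Nonempty)
    (hAB : Disjoint A B) :
    ∫ x, splitStat (bandProduct T) A B x ∂sampleLaw n p S = bandEnergy T S := by
  rw [sampleLaw, integral_splitStat measurable_bandProduct integrable_bandProduct hA hB hAB,
    bandEnergy]
  simp_rw [integral_bandProduct hS]

theorem variance_bandStat_le (hα : 3 / 2 < α) (hS : S ∈ classF α L p) (hp : 0 < p)
    (hA : A.Nonempty) (hAB : Disjoint A B) (hcard : A.card = B.card) :
    Var[splitStat (bandProduct T) A B; sampleLaw n p S]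
      ≤ 4 * (1 + 2 * L + intZeta (2 * α / 3)) ^ 2 * √p / A.card * bandEnergy T S
        + 4 * (2 + 4 * L * intZeta (2 * α)) * (T * p) / (A.card : ℝ) ^ 2 := by
  have hSt : Sᵀ = S := by simpa using hS.1.isHermitian.eq
  rw [sampleLaw, variance_splitStat measurable_bandProduct integrable_bandProduct
    integrable_bandProduct_mul hA hAB hcard]
  simp_rw [integral_bandProduct_mul hS.1, integral_bandProduct hS.1]
  have hP : ((p : ℝ) ^ (1 / 4 : ℝ)) ^ 2 = √p := by
    rw [Real.sqrt_eq_rpow, ← Real.rpow_natCast, ← Real.rpow_mul (Nat.cast_nonneg p)]; norm_num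
  have h1 := sum_mul_productCov_le hSt (sum_abs_row_le hα hS hp) fun q => band T q * S q.1 q.2
  rw [mul_pow, hP] at h1
  have h1' : ∑ q : Fin p × Fin p, ∑ r : Fin p × Fin p, band T q * S q.1 q.2
        * (band T r * S r.1 r.2) * (band T q * band T r * productCov S q r)
      = ∑ q : Fin p × Fin p, ∑ r : Fin p × Fin p, band T q * S q.1 q.2
        * (band T r * S r.1 r.2) * productCov S q r := by
    refine Finset.sum_congr rfl fun q _ => Finset.sum_congr rfl fun r _ => ?_
    have hq := band_sq (T := T) q
    have hr := band_sq (T := T) r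
    calc _ = band T q ^ 2 * band T r ^ 2 * (S q.1 q.2 * S r.1 r.2 * productCov S q r) := by ring
      _ = _ := by rw [hq, hr]; ring
  rw [h1']
  have h2 := (sum_band_productCov_sq_le (T := T) (S := S)).trans
    (mul_le_mul_of_nonneg_left (sum_sum_sq_row_le (by linarith) hS hp) (by positivity))
  calc _ ≤ 2 / (A.card : ℝ) * (2 * ((1 + 2 * L + intZeta (2 * α / 3)) ^ 2 * √p)
          * ∑ q : Fin p × Fin p, (band T q * S q.1 q.2) ^ 2)
        + 1 / (A.card : ℝ) ^ 2 * (4 * T * ((2 + 4 * L * intZeta (2 * α)) * p)) := by gcongr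
    _ = _ := by rw [bandEnergy]; ring

theorem memLp_bandStat (hAB : Disjoint A B) :
    MemLp (splitStat (bandProduct T) A B) 2 (sampleLaw n p S) :=
  memLp_splitStat measurable_bandProduct integrable_bandProduct integrable_bandProduct_mul hAB

end BandStatistic

end InverseCovarianceTest

/-! ### Error bounds for the band test -/

namespace InverseCovarianceTest

open Matrix

variable {n p T : ℕ} {A B : Finset (Fin n)} {α L lam : ℝ}

/-- The test which rejects when the split-sample band statistic exceeds `t`. -/
noncomputable def bandTest (T : ℕ) (A B : Finset (Fin n)) (t : ℝ) : TestProcedure n p where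
  toFun := Set.indicator {x | t < splitStat (bandProduct T) A B x} 1
  measurable_toFun := measurable_one.indicator
    (measurableSet_lt measurable_const (measurable_splitStat measurable_bandProduct A B))
  mem_Icc x := by
    by_cases hx : x ∈ {x | t < splitStat (bandProduct T) A B x} <;> simp [hx]

theorem measurableSet_bandTest (T : ℕ) (A B : Finset (Fin n)) (t : ℝ) :
    MeasurableSet {x : Fin n → EuclideanSpace ℝ (Fin p) | t < splitStat (bandProduct T) A B x} :=
  measurableSet_lt measurable_const (measurable_splitStat measurable_bandProduct A B)

theorem lintegral_bandTest (S : Matrix (Fin p) (Fin p) ℝ) (t : ℝ) :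
    ∫⁻ x, ENNReal.ofReal ((bandTest T A B t).toFun x) ∂sampleLaw n p S
      = sampleLaw n p S {x | t < splitStat (bandProduct T) A B x} := by
  rw [← lintegral_indicator_one (measurableSet_bandTest T A B t)]
  refine lintegral_congr fun x => ?_
  by_cases hx : t < splitStat (bandProduct T) A B x <;> simp [bandTest, Set.indicator, hx]

theorem lintegral_one_sub_bandTest (S : Matrix (Fin p) (Fin p) ℝ) (t : ℝ) :
    ∫⁻ x, ENNReal.ofReal (1 - (bandTest T A B t).toFun x) ∂sampleLaw n p S
      = sampleLaw n p S {x | splitStat (bandProduct T) A B x ≤ t} := by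
  rw [← lintegral_indicator_one (measurableSet_le
    (measurable_splitStat measurable_bandProduct A B) measurable_const)]
  refine lintegral_congr fun x => ?_
  by_cases hx : t < splitStat (bandProduct T) A B x
  · simp [bandTest, Set.indicator, hx, hx.not_ge]
  · simp [bandTest, Set.indicator, hx, not_lt.1 hx]

theorem one_mem_classF (hL : 0 < L) : (1 : Matrix (Fin p) (Fin p) ℝ) ∈ classF α L p := by
  refine ⟨PosSemidef.one, fun i => one_apply_eq i, ?_⟩
  have (i j : Fin p) : (if i < j then (1 : Matrix (Fin p) (Fin p) ℝ) i j ^ 2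
      * |(i : ℝ) - (j : ℝ)| ^ (2 * α) else 0) = 0 := by
    split_ifs with h
    · simp [h.ne]
    · rfl
  simp [this, hL.le]

theorem bandEnergy_one : bandEnergy T (1 : Matrix (Fin p) (Fin p) ℝ) = 0 := by
  refine Finset.sum_eq_zero fun q _ => ?_
  unfold band
  split_ifs with h
  · simp [h.1.ne]
  · simp

theorem eq_one_of_mem_nullInverse {S : Matrix (Fin p) (Fin p) ℝ} (hS : S ∈ nullInverse p)
    (hp : 0 < p) : S = 1 := by
  have : Nonempty (Fin p) := ⟨⟨0, hp⟩⟩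
  -- A singular matrix has inverse `0` by convention, which differs from `1` because `p > 0`.
  by_cases h : IsUnit S.det
  · rw [← nonsing_inv_nonsing_inv S h, hS.2, inv_one]
  · have := nonsing_inv_apply_not_isUnit S h
    rw [hS.2] at this
    exact absurd this one_ne_zero

theorem typeIError_bandTest_le (hα : 3 / 2 < α) (hL : 0 < L) (hp : 0 < p)
    (hA : A.Nonempty) (hAB : Disjoint A B) (hcard : A.card = B.card) {t : ℝ} (ht : 0 < t) :
    typeIError (bandTest T A B t) (nullInverse p) ≤ ENNReal.ofReal
      (4 * (2 + 4 * L * intZeta (2 * α)) * (T * p) / (A.card : ℝ) ^ 2 / t ^ 2) := by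
  have hB : B.Nonempty := by rw [← Finset.card_pos, ← hcard]; exact hA.card_pos
  refine iSup₂_le fun S hS => ?_
  rw [eq_one_of_mem_nullInverse hS hp, lintegral_bandTest]
  have hV := variance_bandStat_le (T := T) hα (one_mem_classF (p := p) hL) hp hA hAB hcard
  rw [bandEnergy_one, mul_zero, zero_add] at hV
  refine le_trans (measure_mono fun x hx => ?_)
    ((meas_ge_le_variance_div_sq (memLp_bandStat (T := T) (S := 1) hAB) ht).trans
      (ENNReal.ofReal_le_ofReal (div_le_div_of_nonneg_right hV (sq_nonneg t))))
  rw [integral_bandStat PosSemidef.one hA hB hAB, bandEnergy_one]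
  exact (show t < splitStat (bandProduct T) A B x from hx).le.trans
    (by rw [sub_zero]; exact le_abs_self _)

/-- If the mean `M` is at least `3t/2`, falling below `t` is a deviation of at least `M/3`. The
variance is affine in `M`, so Chebyshev's bound decreases in `M` and is uniform over the
alternative. -/
theorem measure_bandStat_le_le {S : Matrix (Fin p) (Fin p) ℝ} (hα : 3 / 2 < α)
    (hS : S ∈ classF α L p) (hp : 0 < p) (hA : A.Nonempty)
    (hAB : Disjoint A B) (hcard : A.card = B.card) {t : ℝ} (ht : 0 < t)
    (hM : 3 / 2 * t ≤ bandEnergy T S) :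
    sampleLaw n p S {x | splitStat (bandProduct T) A B x ≤ t} ≤ ENNReal.ofReal
      (9 * (4 * (1 + 2 * L + intZeta (2 * α / 3)) ^ 2 * √p / A.card) / t
        + 9 * (4 * (2 + 4 * L * intZeta (2 * α)) * (T * p) / (A.card : ℝ) ^ 2) / t ^ 2) := by
  have hB : B.Nonempty := by rw [← Finset.card_pos, ← hcard]; exact hA.card_pos
  set M := bandEnergy T S with hMdef
  have hM0 : 0 < M := by linarith
  have hV := variance_bandStat_le (T := T) hα hS hp hA hAB hcard
  rw [← hMdef] at hV
  have hE := integral_bandStat (T := T) hS.1 hA hB hAB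
  rw [← hMdef] at hE
  refine le_trans (measure_mono fun x hx => ?_)
    ((meas_ge_le_variance_div_sq (memLp_bandStat (T := T) (S := S) hAB)
      (show 0 < M / 3 by positivity)).trans (ENNReal.ofReal_le_ofReal ?_))
  · have hx' : splitStat (bandProduct T) A B x ≤ t := hx
    rw [Set.mem_ofPred_eq, hE, abs_sub_comm]
    exact le_trans (by linarith) (le_abs_self _)
  · have hL : 0 ≤ L := by
      refine le_trans ?_ hS.2.2
      exact mul_nonneg (by positivity) (Finset.sum_nonneg fun i _ => Finset.sum_nonneg fun j _ => by
        split_ifs <;> positivity)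
    have hz := intZeta_nonneg (2 * α)
    have htM : t ≤ M := by linarith
    set a := 4 * (1 + 2 * L + intZeta (2 * α / 3)) ^ 2 * √p / A.card with ha
    set b := 4 * (2 + 4 * L * intZeta (2 * α)) * (T * p) / (A.card : ℝ) ^ 2 with hb
    have ha0 : 0 ≤ a := by positivity
    have hb0 : 0 ≤ b := by positivity
    calc _ ≤ (a * M + b) / (M / 3) ^ 2 := by gcongr
      _ = 9 * a / M + 9 * b / M ^ 2 := by field_simp; ring
      _ ≤ _ := by gcongr

/-- The upper-triangular energy is at least `2t` for the threshold `t` used here; truncation loses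
at most `t/2`, leaving the `3t/2` required. -/
theorem typeIIError_bandTest_le (hα : 3 / 2 < α) (hlam : 0 < lam) (hp : 0 < p)
    (hA : A.Nonempty) (hAB : Disjoint A B) (hcard : A.card = B.card) (hT : T ≠ 0) {ψ : ℝ}
    (hψ : 0 < ψ) (hbias : L * (T : ℝ) ^ (-(2 * α)) ≤ lam ^ 2 * ψ ^ 2 / 4) :
    typeIIError (bandTest T A B (p * (lam ^ 2 * ψ ^ 2) / 2)) (altInverse α L lam p ψ)
      ≤ ENNReal.ofReal
      (9 * (4 * (1 + 2 * L + intZeta (2 * α / 3)) ^ 2 * √p / A.card)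
          / (p * (lam ^ 2 * ψ ^ 2) / 2)
        + 9 * (4 * (2 + 4 * L * intZeta (2 * α)) * (T * p) / (A.card : ℝ) ^ 2)
          / (p * (lam ^ 2 * ψ ^ 2) / 2) ^ 2) := by
  have hp' : (0 : ℝ) < p := by exact_mod_cast hp
  refine iSup₂_le fun S hS => ?_
  rw [lintegral_one_sub_bandTest]
  refine measure_bandStat_le_le hα hS.1.1 hp hA hAB hcard (by positivity) ?_
  have h1 := le_sum_upper_sq hlam hp hS
  have h2 := sum_upper_sq_le_bandEnergy_add (by linarith) hT hS.1.1 hp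
  have h3 := mul_le_mul_of_nonneg_left hbias hp'.le
  linarith

theorem totalError_bandTest_le (hα : 3 / 2 < α) (hL : 0 < L) (hlam : 0 < lam) (hp : 0 < p)
    (hA : A.Nonempty) (hAB : Disjoint A B) (hcard : A.card = B.card) (hT : T ≠ 0) {ψ : ℝ}
    (hψ : 0 < ψ) (hbias : L * (T : ℝ) ^ (-(2 * α)) ≤ lam ^ 2 * ψ ^ 2 / 4) :
    totalError (bandTest T A B (p * (lam ^ 2 * ψ ^ 2) / 2)) (nullInverse p)
        (altInverse α L lam p ψ)
      ≤ ENNReal.ofReal (72 * (1 + 2 * L + intZeta (2 * α / 3)) ^ 2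
          / (lam ^ 2 * (A.card * √p * ψ ^ 2))
        + 160 * (2 + 4 * L * intZeta (2 * α)) * T / (lam ^ 4 * (A.card * √p * ψ ^ 2) ^ 2)) := by
  have hp' : (0 : ℝ) < p := by exact_mod_cast hp
  have hA' : (0 : ℝ) < A.card := by exact_mod_cast hA.card_pos
  have hz := intZeta_nonneg (2 * α)
  have ht : 0 < p * (lam ^ 2 * ψ ^ 2) / 2 := by positivity
  refine (add_le_add (typeIError_bandTest_le hα hL hp hA hAB hcard ht)
    (typeIIError_bandTest_le hα hlam hp hA hAB hcard hT hψ hbias)).trans ?_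
  rw [← ENNReal.ofReal_add (by positivity) (by positivity)]
  refine ENNReal.ofReal_le_ofReal (le_of_eq ?_)
  have hm : (A.card : ℝ) ≠ 0 := hA'.ne'
  obtain ⟨s, hs, hps⟩ : ∃ s : ℝ, s ≠ 0 ∧ (p : ℝ) = s ^ 2 ∧ √(p : ℝ) = s :=
    ⟨√(p : ℝ), (Real.sqrt_pos.2 hp').ne', (Real.sq_sqrt hp'.le).symm, rfl⟩
  rw [hps.2, hps.1]
  clear hps ht hp' hbias
  field_simp
  ring

theorem exists_disjoint_half_samples (n : ℕ) :
    ∃ A B : Finset (Fin n), Disjoint A B ∧ A.card = n / 2 ∧ B.card = n / 2 := by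
  obtain ⟨A, -, hA⟩ := Finset.exists_subset_card_eq (s := (Finset.univ : Finset (Fin n)))
    (n := n / 2) (by rw [Finset.card_univ, Fintype.card_fin]; omega)
  obtain ⟨B, hB, hBc⟩ := Finset.exists_subset_card_eq (s := Aᶜ) (n := n / 2)
    (by rw [Finset.card_compl, Fintype.card_fin]; omega)
  exact ⟨A, B, (Finset.disjoint_left.2 fun a ha hb => Finset.mem_compl.1 (hB hb) ha), hA, hBc⟩

theorem totalError_bandTest_le_of_bandwidth (hα : 3 / 2 < α) (hL : 0 < L) (hlam : 0 < lam)
    (hp : 0 < p) (hn : 2 ≤ n) (hAB : Disjoint A B) (hA : A.card = n / 2) (hB : B.card = n / 2)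
    {ψ y q : ℝ} (hψ : 0 < ψ) (hy1 : 1 ≤ y) (hy : y ^ (4 * α + 1) = (n : ℝ) ^ 2 * p)
    (hq : q = ψ * y ^ α) (hbias : 4 * L / lam ^ 2 ≤ q ^ 2) :
    totalError (bandTest ⌈y⌉₊ A B (p * (lam ^ 2 * ψ ^ 2) / 2)) (nullInverse p)
        (altInverse α L lam p ψ)
      ≤ ENNReal.ofReal (216 * (1 + 2 * L + intZeta (2 * α / 3)) ^ 2 / (lam ^ 2 * q ^ 2)
        + 2880 * (2 + 4 * L * intZeta (2 * α)) / (lam ^ 4 * q ^ 4)) := by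
  have hp' : (0 : ℝ) < p := by exact_mod_cast hp
  have hy0 : 0 < y := by linarith
  have hz := intZeta_nonneg (2 * α)
  have hTy : y ≤ ⌈y⌉₊ := Nat.le_ceil y
  have hT2 : (⌈y⌉₊ : ℝ) ≤ 2 * y := by
    have := Nat.ceil_lt_add_one hy0.le
    linarith
  have hT : ⌈y⌉₊ ≠ 0 := (Nat.ceil_pos.2 hy0).ne'
  have hAne : A.Nonempty := by rw [← Finset.card_pos, hA]; omega
  have hcardA : (n : ℝ) ≤ 3 * A.card := by
    have : n ≤ 3 * A.card := by omega
    exact_mod_cast this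
  set u := y ^ α with hu
  have hu0 : 0 < u := by positivity
  have hu2 : y ^ (2 * α) = u ^ 2 := by
    rw [hu, ← Real.rpow_natCast, ← Real.rpow_mul hy0.le]; congr 1; push_cast; ring
  have hu4 : y ^ (4 * α + 1) = u ^ 4 * y := by
    rw [hu, Real.rpow_add hy0, Real.rpow_one, ← Real.rpow_natCast (y ^ α),
      ← Real.rpow_mul hy0.le]
    congr 2; push_cast; ring
  have hq0 : 0 < q := by rw [hq]; positivity
  have hψq : ψ ^ 2 = q ^ 2 / u ^ 2 := by rw [hq]; field_simp
  have hbias' : L * (⌈y⌉₊ : ℝ) ^ (-(2 * α)) ≤ lam ^ 2 * ψ ^ 2 / 4 := by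
    have h1 : (⌈y⌉₊ : ℝ) ^ (-(2 * α)) ≤ y ^ (-(2 * α)) :=
      Real.rpow_le_rpow_of_nonpos hy0 hTy (by linarith)
    rw [Real.rpow_neg hy0.le, hu2] at h1
    rw [div_le_iff₀ (by positivity)] at hbias
    calc L * (⌈y⌉₊ : ℝ) ^ (-(2 * α)) ≤ L * (u ^ 2)⁻¹ := by gcongr
      _ ≤ (q ^ 2 * lam ^ 2 / 4) * (u ^ 2)⁻¹ := by gcongr; linarith
      _ = _ := by rw [hψq]; ring
  -- The signal-to-noise ratio: `n√p ψ² = q²√y` and `|A| ≥ n/3`, so `w ≥ (q²/3)√y`. The factor `√y`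
  -- offsets the band width `T ≤ 2y` in the second error term.
  set w := (A.card : ℝ) * √p * ψ ^ 2 with hw
  have hw2 : y * (q ^ 2 / 3) ^ 2 ≤ w ^ 2 := by
    have h1 : u ^ 4 * y ≤ (3 * A.card) ^ 2 * p := by
      rw [← hu4, hy]; gcongr
    rw [hw, mul_pow, mul_pow, Real.sq_sqrt hp'.le, hψq, div_pow (q ^ 2) (u ^ 2)]
    calc y * (q ^ 2 / 3) ^ 2 = (u ^ 4 * y) * ((q ^ 2) ^ 2 / (9 * u ^ 4)) := by field_simp; ring
      _ ≤ ((3 * A.card) ^ 2 * p) * ((q ^ 2) ^ 2 / (9 * u ^ 4)) := by gcongr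
      _ = _ := by field_simp; ring
  have hA0 : (0 : ℝ) < A.card := by exact_mod_cast hAne.card_pos
  have hw0 : 0 < w := by positivity
  have hw1 : q ^ 2 / 3 ≤ w := by
    refine le_of_sq_le_sq (le_trans ?_ hw2) hw0.le
    exact le_mul_of_one_le_left (sq_nonneg _) hy1
  refine (totalError_bandTest_le hα hL hlam hp hAne hAB (hA.trans hB.symm) hT hψ hbias').trans
    (ENNReal.ofReal_le_ofReal (add_le_add ?_ ?_))
  · calc _ ≤ 72 * (1 + 2 * L + intZeta (2 * α / 3)) ^ 2 / (lam ^ 2 * (q ^ 2 / 3)) := by gcongr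
      _ = _ := by field_simp; ring
  · calc _ ≤ 160 * (2 + 4 * L * intZeta (2 * α)) * (2 * y)
          / (lam ^ 4 * (y * (q ^ 2 / 3) ^ 2)) := by gcongr
      _ = _ := by field_simp; ring

theorem exists_const_mul_div_separationRate_eventuallyEq {α L : ℝ} (hα : 0 < α) (hL : 0 < L) {n p : ℕ → ℕ}
    (hn : Tendsto n atTop atTop) (hp : Tendsto p atTop atTop) (ψ : ℕ → ℝ) :
    ∃ c : ℝ, 0 < c ∧ (fun k => c * (ψ k / separationRate α L (n k) (p k)))
      =ᶠ[atTop] fun k => ψ k * bandwidth α (n k) (p k) ^ α := by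
  have hC := constC_pos hα hL
  refine ⟨(constC α L ^ (1 / 2 : ℝ)) ^ (-(2 * α / (4 * α + 1))), by positivity, ?_⟩
  filter_upwards [(tendsto_bandwidth hα hn hp).eventually_gt_atTop 0] with k hk
  rw [separationRate_eq hα hL, Real.rpow_neg hk.le]
  have : (constC α L ^ (1 / 2 : ℝ)) ^ (-(2 * α / (4 * α + 1))) ≠ 0 := by positivity
  have : bandwidth α (n k) (p k) ^ α ≠ 0 := by positivity
  field_simp

end InverseCovarianceTest

/-- If `α > 3/2`, `L > 0`, `0 < lam < 1` and `n, p → ∞` with `n = o(p^{2α})`, then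
`(n √p C(α, L)^{1/2})^{-2α/(4α+1)}` is the asymptotically minimax separation rate for testing
`Σ⁻¹ = I` against `Σ ∈ G(α, L, lam)` with `(1 / 2p) ‖Σ⁻¹ - I‖²_F ≥ ψ²`. -/
theorem theorem5 (α L lam : ℝ) (hα : 3 / 2 < α) (hL : 0 < L) (hlam₀ : 0 < lam) (hlam₁ : lam < 1)
    (n p : ℕ → ℕ) (hn : Tendsto n atTop atTop) (hp : Tendsto p atTop atTop)
    (hnp : (fun k => (n k : ℝ)) =o[atTop] (fun k => (p k : ℝ) ^ (2 * α))) :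
    InverseCovarianceTest.IsMinimaxSeparationRate InverseCovarianceTest.nullInverse
      (InverseCovarianceTest.altInverse α L lam) n p
      (fun k => InverseCovarianceTest.separationRate α L (n k) (p k)) := by
  have hα0 : 0 < α := by linarith
  refine ⟨fun ψ hψ h => ?_, fun ψ hψ h => ?_⟩
  · obtain ⟨c, hc, hceq⟩ := InverseCovarianceTest.exists_const_mul_div_separationRate_eventuallyEq
      hα0 hL hn hp ψ
    refine InverseCovarianceTest.tendsto_minimaxError_one (by linarith) hL hlam₁ hn hp hnp hψ ?_
    refine Tendsto.congr' hceq ?_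
    simpa using h.const_mul c
  · obtain ⟨c, hc, hceq⟩ := InverseCovarianceTest.exists_const_mul_div_separationRate_eventuallyEq
      hα0 hL hn hp ψ
    have hq := Tendsto.congr' hceq (h.const_mul_atTop hc)
    choose A B hAB hA hB using fun k => InverseCovarianceTest.exists_disjoint_half_samples (n k)
    refine ⟨fun k => InverseCovarianceTest.bandTest
      ⌈InverseCovarianceTest.bandwidth α (n k) (p k)⌉₊ (A k) (B k)
      (p k * (lam ^ 2 * ψ k ^ 2) / 2), ?_⟩
    set q := fun k => ψ k * InverseCovarianceTest.bandwidth α (n k) (p k) ^ α with hqdef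
    have hq2 : Tendsto (fun k => q k ^ 2) atTop atTop := (tendsto_pow_atTop two_ne_zero).comp hq
    have hq4 : Tendsto (fun k => q k ^ 4) atTop atTop := (tendsto_pow_atTop four_ne_zero).comp hq
    have hlim (C₁ C₂ : ℝ) : Tendsto (fun k => ENNReal.ofReal (C₁ / (lam ^ 2 * q k ^ 2)
        + C₂ / (lam ^ 4 * q k ^ 4))) atTop (𝓝 0) := by
      have h1 := (hq2.const_mul_atTop (show 0 < lam ^ 2 by positivity)).const_div_atTop C₁
      have h2 := (hq4.const_mul_atTop (show 0 < lam ^ 4 by positivity)).const_div_atTop C₂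
      simpa using ENNReal.tendsto_ofReal (h1.add h2)
    refine tendsto_of_tendsto_of_tendsto_of_le_of_le' tendsto_const_nhds
      (hlim (216 * (1 + 2 * L + InverseCovarianceTest.intZeta (2 * α / 3)) ^ 2)
        (2880 * (2 + 4 * L * InverseCovarianceTest.intZeta (2 * α))))
      (Eventually.of_forall fun _ => zero_le) ?_
    filter_upwards [hn.eventually_ge_atTop 2, hp.eventually_gt_atTop 0,
      (InverseCovarianceTest.tendsto_bandwidth hα0 hn hp).eventually_ge_atTop 1,
      hq2.eventually_ge_atTop (4 * L / lam ^ 2)] with k h1 h2 h3 h4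
    exact InverseCovarianceTest.totalError_bandTest_le_of_bandwidth hα hL hlam₀ h2 h1 (hAB k) (hA k)
      (hB k) (hψ k) h3 (InverseCovarianceTest.bandwidth_rpow hα0 _ _) rfl h4
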